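/- Let $d\ge 1$, let $\mathbb{D}$ be the open unit disc, $\mathbb{T}$ the unit circle, and let $\pi_d(z)=\left(\sum_j z_j,\sum_{i<j}z_iz_j,\dots,z_1\cdots z_d\right)$ be the symmetrization map on $\mathbb{C}^d$. Let $\mathbb{G}_d=\pi_d(\mathbb{D}^d)$ be the symmetrized polydisc, whose points are written $(s_1,\dots,s_{d-1},p)$, and let $A(\mathbb{G}_d)$ be the algebra of functions that are continuous on $\overline{\mathbb{G}_d}$ and holomorphic in $\mathbb{G}_d$. The distinguished boundary $b\mathbb{G}_d$ is the Shilov boundary with respect to $A(\mathbb{G}_d)$ (it equals $\pi_d(\mathbb{T}^d)$), with the image under $\pi_d$ of Lebesgue measure on $\mathbb{T}^d$. A bounded holomorphic function $f$ on $\mathbb{G}_d$ is inner if for almost every $(s_1,\dots,s_{d-1},p)\in b\mathbb{G}_d$ the radial limit $\lim_{r\to1^-}f(rs_1,r^2s_2,\dots,r^dp)$ exists and has modulus $1$; it is rational inner if it is, in addition, a quotient of two polynomials. (1) For every rational inner function $f$ on $\mathbb{G}_d$ there are an integer $k\ge 0$, a number $\tau\in\mathbb{T}$ and a polynomial $\xi\in\mathbb{C}[s_1,\dots,s_{d-1},p]$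 with no zero in $\mathbb{G}_d$ such that $$f(s_1,\dots,s_{d-1},p)=\tau p^k\,\frac{\overline{\xi\left(\frac{\overline{s_{d-1}}}{\overline p},\dots,\frac{\overline{s_1}}{\overline p},\frac1{\overline p}\right)}}{\xi(s_1,\dots,s_{d-1},p)}\qquad(*)$$ at all points of $\mathbb{G}_d$ with $p\ne0$. (2) Conversely, let $k\ge0$, $\tau\in\mathbb{T}$, and let $\xi$ be a polynomial with no zero in $\mathbb{G}_d$. Then every holomorphic function $f$ on $\mathbb{G}_d$ that satisfies $(*)$ at all points of $\mathbb{G}_d$ with $p\neq 0$ is rational inner. (3) Every inner function $f\in A(\mathbb{G}_d)$ is rational, and there are $k\ge0$, $\tau\in\mathbb{T}$ and a polynomial $\xi$ with no zero in $\overline{\mathbb{G}_d}$ such that $(*)$ holds at all points of $\overline{\mathbb{G}_d}$ with $p\neq0$. -/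

import Mathlib

open Filter Topology MeasureTheory

open scoped ComplexConjugate

namespace SymmetrizedPolydisc

/-- The symmetrization map `z ↦ (e₁(z), …, e_d(z))`; the coordinate of index `i` (counted from `0`)
is the elementary symmetric polynomial of degree `i + 1`. -/
def symmetrization (d : ℕ) (z : Fin d → ℂ) : Fin d → ℂ :=
  fun i => ∑ t ∈ Finset.powersetCard ((i : ℕ) + 1) Finset.univ, ∏ j ∈ t, z j

/-- The open unit polydisc. -/
def polydisc (d : ℕ) : Set (Fin d → ℂ) := {z | ∀ i, ‖z i‖ < 1}

/-- The unit torus. -/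
def torus (d : ℕ) : Set (Fin d → ℂ) := {z | ∀ i, ‖z i‖ = 1}

/-- The symmetrized polydisc. -/
def symPolydisc (d : ℕ) : Set (Fin d → ℂ) := symmetrization d '' polydisc d

/-- Membership in the algebra `A(Ω)` of functions that are continuous on the closure of `Ω` and
holomorphic in `Ω`. -/
def MemUniformAlgebra {d : ℕ} (Ω : Set (Fin d → ℂ)) (f : (Fin d → ℂ) → ℂ) : Prop :=
  ContinuousOn f (closure Ω) ∧ DifferentiableOn ℂ f Ω

/-- `C` is a closed boundary for `A(Ω)`: every function in `A(Ω)` attains on `C` its maximum modulus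
over the closure of `Ω`. -/
def IsClosedBoundary {d : ℕ} (Ω C : Set (Fin d → ℂ)) : Prop :=
  IsClosed C ∧ C ⊆ closure Ω ∧
    ∀ f, MemUniformAlgebra Ω f → ∀ x ∈ closure Ω, ∃ y ∈ C, ‖f x‖ ≤ ‖f y‖

/-- The distinguished boundary of `Ω`: the Shilov boundary for `A(Ω)`, that is the smallest closed
boundary. -/
def distinguishedBoundary {d : ℕ} (Ω : Set (Fin d → ℂ)) : Set (Fin d → ℂ) :=
  ⋂₀ {C | IsClosedBoundary Ω C}

/-- The measure on the distinguished boundary of the symmetrized polydisc with respect to which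
`almost every` is understood: the image of the (Lebesgue) measure of the torus
`{(exp(iθ₁), …, exp(iθ_d))}` under the symmetrization map. -/
noncomputable def boundaryMeasure (d : ℕ) : Measure (Fin d → ℂ) :=
  (volume.restrict (Set.Icc (0 : Fin d → ℝ) (fun _ => 2 * Real.pi))).map
    (fun θ => symmetrization d (torusMap 0 1 θ))

/-- The dilation `(s₁, s₂, …, p) ↦ (r s₁, r² s₂, …, r^d p)`. It takes the symmetrization of `z` to
that of `r z`, so that for `r ↑ 1` it is the radial approach to a boundary point. -/
def dilation {d : ℕ} (r : ℝ) (x : Fin d → ℂ) : Fin d → ℂ :=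
  fun i => (r : ℂ) ^ ((i : ℕ) + 1) * x i

/-- Inner functions on the symmetrized polydisc: bounded holomorphic functions whose radial boundary
values at almost every point of the distinguished boundary exist and lie on the unit circle. -/
def IsInner {d : ℕ} (f : (Fin d → ℂ) → ℂ) : Prop :=
  DifferentiableOn ℂ f (symPolydisc d) ∧
  (∃ M : ℝ, ∀ x ∈ symPolydisc d, ‖f x‖ ≤ M) ∧
  ∀ᵐ x ∂(boundaryMeasure d), x ∈ distinguishedBoundary (symPolydisc d) →
    ∃ w : ℂ, ‖w‖ = 1 ∧ Tendsto (fun r : ℝ => f (dilation r x)) (𝓝[<] 1) (𝓝 w)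

/-- `f` is given on the symmetrized polydisc by a quotient `a / b` of polynomials, `b ≠ 0`. Zeros of
`b` in the domain are not excluded here. -/
def IsRational {d : ℕ} (f : (Fin d → ℂ) → ℂ) : Prop :=
  ∃ a b : MvPolynomial (Fin d) ℂ, b ≠ 0 ∧
    ∀ x ∈ symPolydisc d, MvPolynomial.eval x b ≠ 0 →
      f x = MvPolynomial.eval x a / MvPolynomial.eval x b

/-- Rational inner functions. -/
def IsRationalInner {d : ℕ} (f : (Fin d → ℂ) → ℂ) : Prop := IsRational f ∧ IsInner f

/-- For `x = (s₁, …, s_{d-1}, p)` with `d = n + 1`, the point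
`(conj s_{d-1} / conj p, …, conj s₁ / conj p, 1 / conj p)`. -/
noncomputable def reflection {n : ℕ} (x : Fin (n + 1) → ℂ) : Fin (n + 1) → ℂ :=
  Fin.snoc (α := fun _ => ℂ)
    (fun j : Fin n => conj (x (Fin.castSucc (Fin.rev j))) / conj (x (Fin.last n)))
    (1 / conj (x (Fin.last n)))

/-- On the points `x = (s₁, …, s_{d-1}, p)` of `S` with `p ≠ 0`, where the reflected point makes
sense, `f = τ p^k conj (ξ (reflected point)) / ξ`. -/
def HasInnerForm {n : ℕ} (S : Set (Fin (n + 1) → ℂ)) (f : (Fin (n + 1) → ℂ) → ℂ)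
    (τ : ℂ) (k : ℕ) (ξ : MvPolynomial (Fin (n + 1)) ℂ) : Prop :=
  ∀ x ∈ S, x (Fin.last n) ≠ 0 →
    f x = τ * x (Fin.last n) ^ k * conj (MvPolynomial.eval (reflection x) ξ) /
      MvPolynomial.eval x ξ

/-! The distinguished boundary of the symmetrized polydisc is the symmetrization of the torus, on
which `boundaryMeasure` lives. -/

lemma continuous_symmetrization (d : ℕ) : Continuous (symmetrization d) := by
  unfold symmetrization; fun_prop

lemma differentiable_symmetrization (d : ℕ) : Differentiable ℂ (symmetrization d) := by
  unfold symmetrization; fun_prop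

lemma eval_esymm_eq (d : ℕ) (z : Fin d → ℂ) (i : Fin d) :
    MvPolynomial.eval z (MvPolynomial.esymm (Fin d) ℂ ((i : ℕ) + 1)) = symmetrization d z i := by
  simp [MvPolynomial.esymm, symmetrization, map_sum, map_prod]

lemma symmetrization_smul (d : ℕ) (r : ℝ) (z : Fin d → ℂ) :
    symmetrization d (fun i => (r : ℂ) * z i) = dilation r (symmetrization d z) := by
  ext i
  simp only [symmetrization, dilation, Finset.mul_sum]
  refine Finset.sum_congr rfl fun t ht => ?_
  rw [Finset.prod_mul_distrib, Finset.prod_const, (Finset.mem_powersetCard.1 ht).2]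

lemma symmetrization_comp_perm (d : ℕ) (z : Fin d → ℂ) (σ : Equiv.Perm (Fin d)) :
    symmetrization d (z ∘ σ) = symmetrization d z := by
  ext i
  rw [← eval_esymm_eq, ← eval_esymm_eq, ← MvPolynomial.eval_rename, MvPolynomial.rename_esymm]

lemma isCompact_closedPolydisc (d : ℕ) (R : ℝ) : IsCompact {z : Fin d → ℂ | ∀ i, ‖z i‖ ≤ R} := by
  have h : {z : Fin d → ℂ | ∀ i, ‖z i‖ ≤ R} = Set.pi Set.univ (fun _ => Metric.closedBall 0 R) := by
    ext z; simp
  rw [h]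
  exact isCompact_univ_pi (fun _ => isCompact_closedBall _ _)

lemma isCompact_torus (d : ℕ) : IsCompact (torus d) := by
  have h : torus d = Set.pi Set.univ (fun _ => Metric.sphere 0 1) := by
    ext z; simp [torus]
  rw [h]
  exact isCompact_univ_pi (fun _ => isCompact_sphere _ _)

lemma closedPolydisc_subset (d : ℕ) :
    {z : Fin d → ℂ | ∀ i, ‖z i‖ ≤ 1} ⊆ closure (polydisc d) := by
  have h : polydisc d = Set.pi Set.univ (fun _ => Metric.ball 0 1) := by
    ext z; simp [polydisc]
  intro z hz
  rw [h, closure_pi_set]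
  intro i _
  rw [closure_ball _ one_ne_zero]
  simpa using hz i

lemma closedPolydisc_mapsTo (d : ℕ) {z : Fin d → ℂ} (hz : ∀ i, ‖z i‖ ≤ 1) :
    symmetrization d z ∈ closure (symPolydisc d) :=
  image_closure_subset_closure_image (continuous_symmetrization d)
    ⟨z, closedPolydisc_subset d hz, rfl⟩

lemma closure_symPolydisc_subset (d : ℕ) :
    closure (symPolydisc d) ⊆ symmetrization d '' {z | ∀ i, ‖z i‖ ≤ 1} := by
  refine closure_minimal (Set.image_mono fun z hz i => (hz i).le) ?_
  exact ((isCompact_closedPolydisc d 1).image (continuous_symmetrization d)).isClosed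

lemma exists_torus_radius {d : ℕ} {F : (Fin d → ℂ) → ℂ} (hF : DifferentiableOn ℂ F (polydisc d))
    {R : ℝ} (hR0 : 0 < R) (hR : R < 1) {z : Fin d → ℂ} (hz : ∀ i, ‖z i‖ ≤ R) (S : Finset (Fin d)) :
    ∃ w : Fin d → ℂ, (∀ i, ‖w i‖ ≤ R) ∧ (∀ i ∈ S, ‖w i‖ = R) ∧ ‖F z‖ ≤ ‖F w‖ := by
  classical
  induction S using Finset.induction_on with
  | empty => exact ⟨z, hz, by simp, le_rfl⟩
  | insert a S ha ih =>
    obtain ⟨w, hw, hwS, hle⟩ := ih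
    have hmaps : ∀ t ∈ Metric.closedBall (0 : ℂ) R, Function.update w a t ∈ polydisc d := by
      intro t ht i
      by_cases h : i = a
      · subst h
        simpa using (mem_closedBall_zero_iff.1 ht).trans_lt hR
      · simpa [Function.update_of_ne h] using (hw i).trans_lt hR
    have hdiff : DifferentiableOn ℂ (fun t => F (Function.update w a t))
        (Metric.closedBall (0 : ℂ) R) :=
      hF.comp (fun t _ => (hasFDerivAt_update w t).differentiableAt.differentiableWithinAt) hmaps
    have hd : DiffContOnCl ℂ (fun t => F (Function.update w a t)) (Metric.ball (0 : ℂ) R) := by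
      refine ⟨hdiff.mono Metric.ball_subset_closedBall, ?_⟩
      rw [closure_ball _ hR0.ne']
      exact hdiff.continuousOn
    obtain ⟨t, ht, hmax⟩ := Complex.exists_mem_frontier_isMaxOn_norm Metric.isBounded_ball
      ⟨0, Metric.mem_ball_self hR0⟩ hd
    rw [frontier_ball _ hR0.ne', mem_sphere_zero_iff_norm] at ht
    refine ⟨Function.update w a t, ?_, ?_, ?_⟩
    · intro i
      by_cases h : i = a
      · subst h; simp [ht]
      · simpa [Function.update_of_ne h] using hw i
    · intro i hi
      by_cases h : i = a
      · subst h; simp [ht]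
      · rw [Function.update_of_ne h]
        exact hwS i ((Finset.mem_insert.1 hi).resolve_left h)
    · refine hle.trans ?_
      have h1 : w a ∈ closure (Metric.ball (0 : ℂ) R) := by
        rw [closure_ball _ hR0.ne']; simpa using hw a
      simpa using hmax h1

lemma isClosedBoundary_torus (d : ℕ) :
    IsClosedBoundary (symPolydisc d) (symmetrization d '' torus d) := by
  refine ⟨((isCompact_torus d).image (continuous_symmetrization d)).isClosed, ?_, ?_⟩
  · rintro _ ⟨z, hz, rfl⟩
    exact closedPolydisc_mapsTo d fun i => (hz i).le
  rintro f ⟨hfc, hfd⟩ x hx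
  have hne : (torus d).Nonempty := ⟨fun _ => 1, fun _ => by simp⟩
  have hFc : ContinuousOn (fun z => f (symmetrization d z)) {z : Fin d → ℂ | ∀ i, ‖z i‖ ≤ 1} :=
    hfc.comp (continuous_symmetrization d).continuousOn fun z hz => closedPolydisc_mapsTo d hz
  have hFd : DifferentiableOn ℂ (fun z => f (symmetrization d z)) (polydisc d) :=
    hfd.comp (differentiable_symmetrization d).differentiableOn fun z hz => ⟨z, hz, rfl⟩
  have hT : torus d ⊆ {z : Fin d → ℂ | ∀ i, ‖z i‖ ≤ 1} := fun z hz i => (hz i).le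
  obtain ⟨w, hw, hmax⟩ := (isCompact_torus d).exists_isMaxOn hne (hFc.mono hT).norm
  refine ⟨symmetrization d w, ⟨w, hw, rfl⟩, ?_⟩
  refine ContinuousWithinAt.closure_le (f := fun y => ‖f y‖) hx
    ((hfc x hx).mono subset_closure).norm continuousWithinAt_const ?_
  rintro _ ⟨z, hz, rfl⟩
  -- radii increasing to one
  have hR : ∀ᶠ m : ℕ in atTop, ∀ i, ‖z i‖ ≤ 1 - 1 / ((m : ℝ) + 2) := by
    rw [eventually_all]
    intro i
    have h2 : Tendsto (fun m : ℕ => 1 - 1 / ((m : ℝ) + 2)) atTop (𝓝 (1 - 0)) := by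
      refine tendsto_const_nhds.sub ?_
      have := (tendsto_add_atTop_iff_nat 1).2 (tendsto_one_div_add_atTop_nhds_zero_nat (𝕜 := ℝ))
      refine this.congr fun m => ?_
      push_cast; ring
    have := h2.eventually (lt_mem_nhds (by simpa using hz i : ‖z i‖ < 1 - 0))
    exact this.mono fun m hm => hm.le
  obtain ⟨m₀, hm₀⟩ := eventually_atTop.1 hR
  have hpos : ∀ m : ℕ, 0 < 1 - 1 / ((m : ℝ) + 2) ∧ 1 - 1 / ((m : ℝ) + 2) < 1 := by
    intro m
    have : (0 : ℝ) < (m : ℝ) + 2 := by positivity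
    constructor
    · rw [sub_pos, div_lt_one this]; linarith [(Nat.cast_nonneg m : (0 : ℝ) ≤ m)]
    · have : 0 < 1 / ((m : ℝ) + 2) := by positivity
      linarith
  have hex : ∀ m : ℕ, ∃ v : Fin d → ℂ, (∀ i, ‖v i‖ = 1 - 1 / (((m + m₀ : ℕ) : ℝ) + 2)) ∧
      ‖f (symmetrization d z)‖ ≤ ‖f (symmetrization d v)‖ := by
    intro m
    obtain ⟨v, -, hv, hle⟩ := exists_torus_radius hFd (hpos (m + m₀)).1 (hpos (m + m₀)).2
      (hm₀ (m + m₀) (Nat.le_add_left _ _)) Finset.univ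
    exact ⟨v, fun i => hv i (Finset.mem_univ i), hle⟩
  choose v hv hle using hex
  obtain ⟨u, hu, φ, hφ, hlim⟩ := (isCompact_closedPolydisc d 1).tendsto_subseq (x := v)
    (fun m i => by rw [hv]; exact (hpos _).2.le)
  have huT : u ∈ torus d := by
    intro i
    have h1 : Tendsto (fun m => ‖v (φ m) i‖) atTop (𝓝 ‖u i‖) :=
      ((tendsto_pi_nhds.1 hlim) i).norm
    have h2 : Tendsto (fun m => ‖v (φ m) i‖) atTop (𝓝 1) := by
      have h3 : Tendsto (fun m : ℕ => 1 - 1 / (((m + m₀ : ℕ) : ℝ) + 2)) atTop (𝓝 (1 - 0)) := by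
        refine tendsto_const_nhds.sub ?_
        have := (tendsto_add_atTop_iff_nat (m₀ + 1)).2
          (tendsto_one_div_add_atTop_nhds_zero_nat (𝕜 := ℝ))
        refine this.congr fun m => ?_
        push_cast; ring
      rw [sub_zero] at h3
      exact (h3.comp hφ.tendsto_atTop).congr fun m => (hv (φ m) i).symm
    exact tendsto_nhds_unique h1 h2
  have hF : Tendsto (fun m => ‖f (symmetrization d (v (φ m)))‖) atTop
      (𝓝 ‖f (symmetrization d u)‖) := by
    have := (hFc u hu).norm
    refine this.tendsto.comp (tendsto_nhdsWithin_iff.2 ⟨hlim, Eventually.of_forall fun m i => ?_⟩)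
    exact (hv (φ m) i).trans_le (hpos _).2.le
  exact (ge_of_tendsto' hF fun m => hle (φ m)).trans (hmax huT)

lemma factor_le {a b : ℂ} (ha : ‖a‖ = 1) (hb : ‖b‖ ≤ 1) : ‖(1 + conj a * b) / 2‖ ≤ 1 := by
  rw [norm_div, div_le_one (by simp)]
  calc ‖1 + conj a * b‖ ≤ ‖(1 : ℂ)‖ + ‖conj a * b‖ := norm_add_le _ _
    _ ≤ ‖(2 : ℂ)‖ := by simp [ha]; linarith

lemma factor_lt {a b : ℂ} (ha : ‖a‖ = 1) (hb : ‖b‖ ≤ 1) (hab : b ≠ a) :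
    ‖(1 + conj a * b) / 2‖ < 1 := by
  have hc : ‖conj a * b‖ ≤ 1 := by simpa [ha] using hb
  have hne : conj a * b ≠ 1 := by
    intro h
    apply hab
    have h1 : a * conj a = 1 := by rw [Complex.mul_conj']; simp [ha]
    calc b = (a * conj a) * b := by rw [h1, one_mul]
      _ = a * (conj a * b) := by ring
      _ = a := by rw [h, mul_one]
  generalize conj a * b = c at hc hne
  rw [norm_div, div_lt_one (by simp)]
  refine lt_of_not_ge fun h => hne ?_
  have h2 : (2 : ℝ) ≤ ‖1 + c‖ := by simpa using h
  have hre : c.re = 1 := by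
    have h3 : ‖1 + c‖ ^ 2 = 1 + 2 * c.re + ‖c‖ ^ 2 := by
      rw [← Complex.normSq_eq_norm_sq, ← Complex.normSq_eq_norm_sq, Complex.normSq_apply,
        Complex.normSq_apply]
      simp; ring
    have h4 : c.re ≤ ‖c‖ := Complex.re_le_norm c
    nlinarith [norm_nonneg c]
  have him : c.im = 0 := by
    have h5 : ‖c‖ ^ 2 = c.re * c.re + c.im * c.im := by
      rw [← Complex.normSq_eq_norm_sq, Complex.normSq_apply]
    nlinarith [norm_nonneg c]
  exact Complex.ext (by simpa using hre) (by simpa using him)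

/-- A polynomial on the closed polydisc that peaks exactly at the point `ζ` of the torus. -/
noncomputable def peak {d : ℕ} (ζ : Fin d → ℂ) : MvPolynomial (Fin d) ℂ :=
  ∏ j, MvPolynomial.C (1 / 2) * (1 + MvPolynomial.C (conj (ζ j)) * MvPolynomial.X j)

lemma eval_peak {d : ℕ} (ζ z : Fin d → ℂ) :
    MvPolynomial.eval z (peak ζ) = ∏ j, (1 + conj (ζ j) * z j) / 2 := by
  simp only [peak, map_prod, map_mul, map_add, map_one, MvPolynomial.eval_C, MvPolynomial.eval_X]
  exact Finset.prod_congr rfl fun j _ => by ring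

lemma eval_peak_self {d : ℕ} {ζ : Fin d → ℂ} (hζ : ζ ∈ torus d) :
    MvPolynomial.eval ζ (peak ζ) = 1 := by
  rw [eval_peak]
  refine Finset.prod_eq_one fun j _ => ?_
  have : conj (ζ j) * ζ j = 1 := by rw [Complex.conj_mul']; simp [hζ j]
  rw [this]; norm_num

lemma norm_eval_peak_lt {d : ℕ} {ζ z : Fin d → ℂ} (hζ : ζ ∈ torus d) (hz : ∀ i, ‖z i‖ ≤ 1)
    (hne : z ≠ ζ) : ‖MvPolynomial.eval z (peak ζ)‖ < 1 := by
  obtain ⟨i, hi⟩ := Function.ne_iff.1 hne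
  rw [eval_peak, norm_prod, ← Finset.mul_prod_erase _ _ (Finset.mem_univ i)]
  refine mul_lt_one_of_nonneg_of_lt_one_left (norm_nonneg _) (factor_lt (hζ i) (hz i) hi) ?_
  exact Finset.prod_le_one (fun _ _ => norm_nonneg _) fun j _ => factor_le (hζ j) (hz j)

lemma exists_symmetric_lift {d : ℕ} (q : MvPolynomial (Fin d) ℂ) :
    ∃ Q : MvPolynomial (Fin d) ℂ, ∀ z : Fin d → ℂ, MvPolynomial.eval (symmetrization d z) Q =
      ∑ σ : Equiv.Perm (Fin d), MvPolynomial.eval (z ∘ σ) q := by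
  have hs : (∑ σ : Equiv.Perm (Fin d), MvPolynomial.rename σ q).IsSymmetric := by
    intro e
    rw [map_sum]
    simp_rw [MvPolynomial.rename_rename]
    exact Fintype.sum_equiv (Equiv.mulLeft e) _ _ fun σ => rfl
  obtain ⟨Q, hQ⟩ := MvPolynomial.esymmAlgHom_fin_surjective ℂ (le_refl d)
    (⟨_, hs⟩ : MvPolynomial.symmetricSubalgebra (Fin d) ℂ)
  refine ⟨Q, fun z => ?_⟩
  have h := congrArg (fun s : MvPolynomial.symmetricSubalgebra (Fin d) ℂ =>
    MvPolynomial.eval z (s : MvPolynomial (Fin d) ℂ)) hQ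
  simp only [MvPolynomial.esymmAlgHom_apply, map_sum, MvPolynomial.eval_rename] at h
  rw [← h]
  have h' : symmetrization d z = fun i : Fin d =>
      MvPolynomial.eval z (MvPolynomial.esymm (Fin d) ℂ ((i : ℕ) + 1)) := by
    ext i; rw [eval_esymm_eq]
  rw [h']
  clear h hQ h'
  induction Q using MvPolynomial.induction_on with
  | C a => simp
  | add p q hp hq => simp [hp, hq]
  | mul_X p i hp => simp [hp]

/-- The distinguished boundary of the symmetrized polydisc is the symmetrization of the torus. -/
theorem distinguishedBoundary_symPolydisc (d : ℕ) :
    distinguishedBoundary (symPolydisc d) = symmetrization d '' torus d := by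
  refine Set.Subset.antisymm (Set.sInter_subset_of_mem (isClosedBoundary_torus d)) ?_
  rintro _ ⟨ζ, hζ, rfl⟩ C ⟨hCc, hCs, hC⟩
  by_contra hζC
  choose Q hQ using fun N : ℕ => exists_symmetric_lift (peak ζ ^ N)
  have hQA : ∀ N, MemUniformAlgebra (symPolydisc d) fun x => MvPolynomial.eval x (Q N) := by
    intro N
    have hdiff : Differentiable ℂ fun x : Fin d → ℂ => MvPolynomial.eval x (Q N) :=
      fun x => (AnalyticOnNhd.eval_mvPolynomial (Q N) x (Set.mem_univ x)).differentiableAt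
    exact ⟨hdiff.continuous.continuousOn, hdiff.differentiableOn⟩
  choose y hyC hy using fun N : ℕ =>
    hC _ (hQA N) _ (closedPolydisc_mapsTo d fun i => (hζ i).le)
  -- the uniform bound away from the peak
  set K : Set (Fin d → ℂ) := {z | ∀ i, ‖z i‖ ≤ 1} ∩ symmetrization d ⁻¹' C with hK
  have hKc : IsCompact K :=
    (isCompact_closedPolydisc d 1).inter_right (hCc.preimage (continuous_symmetrization d))
  have hρ : ∃ ρ : ℝ, 0 ≤ ρ ∧ ρ < 1 ∧ ∀ z ∈ K, ‖MvPolynomial.eval z (peak ζ)‖ ≤ ρ := by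
    rcases K.eq_empty_or_nonempty with h | h
    · exact ⟨0, le_rfl, one_pos, by simp [h]⟩
    obtain ⟨u, hu, hmax⟩ := hKc.exists_isMaxOn h
      (f := fun z => ‖MvPolynomial.eval z (peak ζ)‖)
      (MvPolynomial.continuous_eval (peak ζ)).norm.continuousOn
    refine ⟨_, norm_nonneg _, norm_eval_peak_lt hζ hu.1 ?_, fun z hz => hmax hz⟩
    rintro rfl
    exact hζC hu.2
  obtain ⟨ρ, hρ0, hρ1, hρK⟩ := hρ
  have hup : ∀ N, ‖MvPolynomial.eval (y N) (Q N)‖ ≤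
      (Fintype.card (Equiv.Perm (Fin d)) : ℝ) * ρ ^ N := by
    intro N
    obtain ⟨z, hz, hzy⟩ := closure_symPolydisc_subset d (hCs (hyC N))
    rw [← hzy, hQ N]
    refine (norm_sum_le _ _).trans ?_
    rw [← nsmul_eq_mul, ← Finset.card_univ]
    refine Finset.sum_le_card_nsmul _ _ _ fun σ _ => ?_
    rw [map_pow, norm_pow]
    refine pow_le_pow_left₀ (norm_nonneg _) (hρK _ ⟨fun i => hz (σ i), ?_⟩) N
    have h : symmetrization d (z ∘ σ) ∈ C := by
      rw [symmetrization_comp_perm, hzy]; exact hyC N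
    exact h
  have hup0 : Tendsto (fun N : ℕ => (Fintype.card (Equiv.Perm (Fin d)) : ℝ) * ρ ^ N) atTop
      (𝓝 0) := by
    simpa using (tendsto_pow_atTop_nhds_zero_of_lt_one hρ0 hρ1).const_mul
      (Fintype.card (Equiv.Perm (Fin d)) : ℝ)
  classical
  have hlow : Tendsto (fun N => MvPolynomial.eval (symmetrization d ζ) (Q N)) atTop
      (𝓝 (∑ σ : Equiv.Perm (Fin d), if ζ ∘ σ = ζ then 1 else 0)) := by
    simp_rw [hQ, map_pow]
    refine tendsto_finsetSum _ fun σ _ => ?_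
    split_ifs with h
    · rw [h, eval_peak_self hζ]
      exact tendsto_const_nhds.congr fun N => (one_pow N).symm
    · exact tendsto_pow_atTop_nhds_zero_of_norm_lt_one
        (norm_eval_peak_lt hζ (fun i => (hζ (σ i)).le) h)
  have hzero := tendsto_nhds_unique hlow
    (squeeze_zero_norm (fun N => (hy N).trans (hup N)) hup0)
  rw [Finset.sum_boole, Nat.cast_eq_zero, Finset.card_eq_zero] at hzero
  have : (1 : Equiv.Perm (Fin d)) ∈ Finset.univ.filter fun σ : Equiv.Perm (Fin d) => ζ ∘ σ = ζ := by
    simp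
  rw [hzero] at this
  simp at this

end SymmetrizedPolydisc

namespace SymmetrizedPolydisc

open MvPolynomial

/-! Everything is pulled back to the polydisc: `F = f ∘ symmetrization` is invariant under
permutations, and a symmetric polynomial in `z` is a polynomial in `(s, p)`.

(1) Write `F = A / B` with coprime polynomials. Wherever `B` vanishes in the polydisc, so does `A`.
This cannot happen for coprime polynomials: a zero of an irreducible factor of `B` persists on all
nearby lines, whereas the lines meeting a common zero have directions in the zero set of a nonzero
polynomial (`exists_elimination`, `eval_ne_zero_of_isRelPrime`). Uniqueness of the reduced fraction
makes `A` and `B` symmetric, so `f = a / b` (`exists_isRelPrime_mul_eq`). Innerness gives `|a| =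
|b|` on the symmetrized torus. Its points are fixed by reflection, so with `q*(x) = p^N conj (q
(reflection x))` one gets `a a* = b b*` there, hence identically, and coprimality determines `a` as
the reflection of `b` up to a unimodular constant and a power of `p` (`exists_eval_eq_reflection`).

(2) Continuity at `p = 0` makes `f ξ` a polynomial `H` (`exists_polynomial_numerator`), and `|H| =
|ξ|` on the symmetrized torus. The maximum principle, applied to dilated quotients, gives `|f| ≤ 1`.
Radial limits exist at every point of the symmetrized torus, because along a ray the common zeros of
numerator and denominator cancel (`exists_tendsto_div_of_norm_eval_eq`).

(3) The slices `t ↦ F (t ζ)`, `ζ` in the torus, are inner in the disc algebra, hence rational.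
Baire's theorem turns this into one linear recurrence with polynomial coefficients for the
homogeneous components of `F`, so `F` is rational (`exists_recurrence`,
`exists_polynomial_mul_eq_of_inner`) and `f = a / b` as in (1). A zero of `b` on the symmetrized
torus would, by continuity of `F` and reflection, produce common zeros of the coprime pullbacks over
an open piece of the torus, against elimination (`eval_ne_zero_on_torus`). The maximum principle for
`1 / b` excludes zeros on the rest of the closure (`eval_ne_zero_on_closure`). -/

lemma isOpen_polydisc (d : ℕ) : IsOpen (polydisc d) := by
  have h : polydisc d = Set.pi Set.univ (fun _ => Metric.ball 0 1) := by
    ext z; simp [polydisc]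
  rw [h]
  exact isOpen_set_pi Set.finite_univ fun _ _ => Metric.isOpen_ball

lemma zero_mem_polydisc (d : ℕ) : (0 : Fin d → ℂ) ∈ polydisc d := fun i => by simp

/-! ### Pullback of polynomials, and sets of uniqueness for polynomials. -/

lemma differentiable_eval {σ : Type*} [Fintype σ] (q : MvPolynomial σ ℂ) :
    Differentiable ℂ fun x : σ → ℂ => eval x q :=
  fun x => (AnalyticOnNhd.eval_mvPolynomial q x (Set.mem_univ x)).differentiableAt

/-- Composition with the symmetrization map, on polynomials. -/
noncomputable def pullback (d : ℕ) : MvPolynomial (Fin d) ℂ →ₐ[ℂ] MvPolynomial (Fin d) ℂ :=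
  aeval fun i => esymm (Fin d) ℂ ((i : ℕ) + 1)

@[simp]
lemma eval_pullback {d : ℕ} (z : Fin d → ℂ) (q : MvPolynomial (Fin d) ℂ) :
    eval z (pullback d q) = eval (symmetrization d z) q := by
  have h' : symmetrization d z = fun i : Fin d => eval z (esymm (Fin d) ℂ ((i : ℕ) + 1)) := by
    ext i; rw [eval_esymm_eq]
  rw [h']
  induction q using MvPolynomial.induction_on with
  | C a => simp [pullback]
  | add p q hp hq => simp only [map_add, hp, hq]
  | mul_X p i hp => simp only [map_mul, hp]; simp [pullback]

lemma coe_esymmAlgHom (d : ℕ) (q : MvPolynomial (Fin d) ℂ) :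
    (esymmAlgHom (Fin d) ℂ d q : MvPolynomial (Fin d) ℂ) = pullback d q := by
  rw [esymmAlgHom_apply]; rfl

lemma pullback_injective (d : ℕ) : Function.Injective (pullback d) := by
  intro p q h
  refine esymmAlgHom_fin_injective ℂ (le_refl d) (Subtype.ext ?_)
  rw [coe_esymmAlgHom, coe_esymmAlgHom, h]

lemma exists_pullback_eq {d : ℕ} {q : MvPolynomial (Fin d) ℂ} (hq : q.IsSymmetric) :
    ∃ Q, pullback d Q = q := by
  obtain ⟨Q, hQ⟩ := esymmAlgHom_fin_surjective ℂ (le_refl d)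
    (⟨q, hq⟩ : symmetricSubalgebra (Fin d) ℂ)
  exact ⟨Q, by rw [← coe_esymmAlgHom, hQ]⟩

lemma eq_zero_of_eventually_eval_eq_zero {d : ℕ} {p : MvPolynomial (Fin d) ℂ} {z₀ : Fin d → ℂ}
    (h : ∀ᶠ z in 𝓝 z₀, eval z p = 0) : p = 0 := by
  obtain ⟨ε, hε, hs⟩ := Metric.eventually_nhds_iff_ball.1 h
  refine funext_set (fun i => Metric.ball (z₀ i) ε) (fun i => ?_) fun x hx => ?_
  · exact infinite_of_mem_nhds (z₀ i) (Metric.ball_mem_nhds _ hε)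
  · rw [map_zero]
    refine hs x ?_
    rw [ball_pi _ hε]
    exact hx

lemma eq_zero_of_eval_eq_zero_on_polydisc {d : ℕ} {p : MvPolynomial (Fin d) ℂ}
    (h : ∀ z ∈ polydisc d, eval z p = 0) : p = 0 :=
  eq_zero_of_eventually_eval_eq_zero (z₀ := 0)
    (eventually_of_mem ((isOpen_polydisc d).mem_nhds (zero_mem_polydisc d)) h)

lemma torusMap_mem_torus {d : ℕ} (θ : Fin d → ℝ) : torusMap 0 1 θ ∈ torus d := by
  intro i; simp [torusMap, Complex.norm_exp]

lemma exists_torusMap_eq {d : ℕ} {ζ : Fin d → ℂ} (hζ : ζ ∈ torus d) :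
    ∃ θ : Fin d → ℝ, torusMap 0 1 θ = ζ := by
  refine ⟨fun i => (ζ i).arg, ?_⟩
  ext i
  have := Complex.norm_mul_exp_arg_mul_I (ζ i)
  simpa [torusMap, hζ i] using this

lemma continuous_torusMap (d : ℕ) : Continuous (torusMap (0 : Fin d → ℂ) 1) := by
  unfold torusMap; fun_prop

lemma eq_zero_of_eventually_eval_torusMap_eq_zero {d : ℕ} {p : MvPolynomial (Fin d) ℂ}
    {θ₀ : Fin d → ℝ} (h : ∀ᶠ θ in 𝓝 θ₀, eval (torusMap 0 1 θ) p = 0) : p = 0 := by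
  obtain ⟨ε, hε, hs⟩ := Metric.eventually_nhds_iff_ball.1 h
  -- Arcs of half-length at most `π`: `t ↦ exp (i t)` is injective on each, so the arcs are infinite
  -- and their product is a set of uniqueness for polynomials.
  set δ := min ε Real.pi
  have hδ : 0 < δ := lt_min hε Real.pi_pos
  refine funext_set (fun i => (fun t : ℝ => Complex.exp (t * Complex.I)) ''
    Metric.ball (θ₀ i) δ) (fun i => ?_) fun x hx => ?_
  · refine Set.Infinite.image ?_ (infinite_of_mem_nhds (θ₀ i) (Metric.ball_mem_nhds _ hδ))
    intro s hs t ht hst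
    have h1 : Complex.exp (((s - θ₀ i : ℝ) : ℂ) * Complex.I) =
        Complex.exp (((t - θ₀ i : ℝ) : ℂ) * Complex.I) := by
      push_cast
      rw [sub_mul, sub_mul, Complex.exp_sub, Complex.exp_sub]
      simpa using hst
    rw [Metric.mem_ball, Real.dist_eq, abs_lt] at hs ht
    have hδπ : δ ≤ Real.pi := min_le_right _ _
    have := Complex.exp_inj_of_neg_pi_lt_of_le_pi (by simp; linarith) (by simp; linarith)
      (by simp; linarith) (by simp; linarith) h1
    have h2 := mul_right_cancel₀ Complex.I_ne_zero this
    have h3 : s - θ₀ i = t - θ₀ i := by exact_mod_cast h2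
    linarith
  · choose θ hθ hx using fun i => hx i (Set.mem_univ i)
    have hx : torusMap 0 1 θ = x := by
      ext i; rw [← hx i]; simp [torusMap]
    rw [map_zero, ← hx]
    refine hs θ ?_
    rw [ball_pi _ hε]
    exact fun i _ => Metric.ball_subset_ball (min_le_left _ _) (hθ i)

lemma eq_zero_of_eval_eq_zero_on_torus {d : ℕ} {p : MvPolynomial (Fin d) ℂ}
    (h : ∀ z ∈ torus d, eval z p = 0) : p = 0 :=
  eq_zero_of_eventually_eval_torusMap_eq_zero (θ₀ := 0)
    (Eventually.of_forall fun θ => h _ (torusMap_mem_torus θ))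

/-! ### Persistence of zeros, and elimination along lines through a point. -/

/-- The zeros of a holomorphic function of one variable depend continuously on parameters. -/
lemma eventually_exists_zero_near {X : Type*} [TopologicalSpace X] {φ : X → ℂ → ℂ}
    (hc : Continuous fun q : X × ℂ => φ q.1 q.2) (hd : ∀ x, Differentiable ℂ (φ x))
    {x₀ : X} {t₀ t₁ : ℂ} (h0 : φ x₀ t₀ = 0) (h1 : φ x₀ t₁ ≠ 0) {ε : ℝ} (hε : 0 < ε) :
    ∀ᶠ x in 𝓝 x₀, ∃ t ∈ Metric.ball t₀ ε, φ x t = 0 := by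
  -- The point `t₁` prevents `φ x₀` from vanishing identically, so its zero `t₀` is isolated.
  have hiso : ∀ᶠ t in 𝓝[≠] t₀, φ x₀ t ≠ 0 := by
    have ha : AnalyticOnNhd ℂ (φ x₀) Set.univ := fun t _ => (hd x₀).analyticAt t
    rcases (ha t₀ (Set.mem_univ _)).eventually_eq_zero_or_eventually_ne_zero with h | h
    · exact absurd (ha.eqOn_of_preconnected_of_eventuallyEq (g := fun _ => 0)
        (fun _ _ => analyticAt_const) isPreconnected_univ (Set.mem_univ t₀) h (Set.mem_univ t₁)) h1
    · exact h
  obtain ⟨δ', hδ', hs⟩ := Metric.mem_nhdsWithin_iff.1 hiso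
  set δ := min δ' ε / 2
  have hδ : 0 < δ := half_pos (lt_min hδ' hε)
  have hδ1 : δ < δ' := by have := min_le_left δ' ε; have := lt_min hδ' hε; simp only [δ]; linarith
  have hδ2 : δ < ε := by have := min_le_right δ' ε; have := lt_min hδ' hε; simp only [δ]; linarith
  have hne : ∀ t ∈ Metric.sphere t₀ δ, φ x₀ t ≠ 0 := by
    intro t ht
    refine hs ⟨?_, ?_⟩
    · rw [Metric.mem_ball, Metric.mem_sphere.1 ht]; exact hδ1
    · rintro rfl
      simp at ht
      linarith
  obtain ⟨u, hu, hmin⟩ := (isCompact_sphere t₀ δ).exists_isMinOn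
    (NormedSpace.sphere_nonempty.2 hδ.le) (f := fun t => ‖φ x₀ t‖)
    ((hd x₀).continuous.norm.continuousOn)
  set m := ‖φ x₀ u‖
  have hm : 0 < m := norm_pos_iff.2 (hne u hu)
  have hA : ∀ᶠ x in 𝓝 x₀, ∀ t ∈ Metric.sphere t₀ δ, m / 2 < ‖φ x t‖ := by
    refine (isCompact_sphere t₀ δ).eventually_forall_of_forall_eventually fun t ht => ?_
    have h2 : m / 2 < ‖φ x₀ t‖ := (half_lt_self hm).trans_le (hmin ht)
    exact (hc.norm.continuousAt (x := (x₀, t))).eventually (lt_mem_nhds h2)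
  have hB : ∀ᶠ x in 𝓝 x₀, ‖φ x t₀‖ < m / 2 := by
    have : Continuous fun x => ‖φ x t₀‖ := (hc.comp (by fun_prop : Continuous fun x => (x, t₀))).norm
    exact this.continuousAt.eventually (gt_mem_nhds (by simpa [h0] using half_pos hm))
  filter_upwards [hA, hB] with x hxA hxB
  -- Without a zero, the maximum principle for `1 / φ x` bounds its value at the centre by `2 / m`,
  -- against `‖φ x t₀‖ < m / 2`.
  by_contra hno
  push Not at hno
  have hne' : ∀ t ∈ Metric.closedBall t₀ δ, φ x t ≠ 0 := fun t ht =>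
    hno t (Metric.closedBall_subset_ball hδ2 ht)
  have hdc : DiffContOnCl ℂ (fun t => (φ x t)⁻¹) (Metric.ball t₀ δ) := by
    refine DifferentiableOn.diffContOnCl ?_
    rw [closure_ball _ hδ.ne']
    exact fun t ht => ((hd x t).inv (hne' t ht)).differentiableWithinAt
  have hle := Complex.norm_le_of_forall_mem_frontier_norm_le Metric.isBounded_ball hdc
    (C := (m / 2)⁻¹) (fun t ht => ?_) (subset_closure (Metric.mem_ball_self hδ))
  · rw [norm_inv] at hle
    have h3 : 0 < ‖φ x t₀‖ := norm_pos_iff.2 (hne' t₀ (Metric.mem_closedBall_self hδ.le))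
    have := (inv_le_inv₀ h3 (half_pos hm)).1 hle
    linarith
  · rw [frontier_ball _ hδ.ne'] at ht
    rw [norm_inv]
    exact inv_anti₀ (half_pos hm) (hxA t ht).le

section Elimination

variable {σ : Type*}

/-- The substitution `f ↦ f (c + t z)`, as a polynomial in `t` over the polynomials in `z`. -/
noncomputable def alongLine (c : σ → ℂ) :
    MvPolynomial σ ℂ →+* Polynomial (MvPolynomial σ ℂ) :=
  (aeval fun i => Polynomial.C (C (c i)) + Polynomial.X * Polynomial.C (X i) :
    MvPolynomial σ ℂ →ₐ[ℂ] Polynomial (MvPolynomial σ ℂ)).toRingHom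

/-- The substitution `g (z, t) ↦ g (c + t z, t)`. -/
noncomputable def alongLine₂ (c : σ → ℂ) :
    Polynomial (MvPolynomial σ ℂ) →+* Polynomial (MvPolynomial σ ℂ) :=
  Polynomial.eval₂RingHom (alongLine c) Polynomial.X

/-- Evaluation at `(z, t)`. -/
noncomputable def eval₂At (z : σ → ℂ) (t : ℂ) : Polynomial (MvPolynomial σ ℂ) →+* ℂ :=
  Polynomial.eval₂RingHom (eval z) t

lemma alongLine_C (c : σ → ℂ) (r : ℂ) :
    alongLine c (C r) = Polynomial.C (C r) := by
  simp only [alongLine, AlgHom.toRingHom_eq_coe, RingHom.coe_coe, algHom_C]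
  rfl

lemma alongLine_X (c : σ → ℂ) (i : σ) :
    alongLine c (X i) = Polynomial.C (C (c i)) + Polynomial.X * Polynomial.C (X i) := by
  simp [alongLine]

lemma alongLine₂_C (c : σ → ℂ) (f : MvPolynomial σ ℂ) :
    alongLine₂ c (Polynomial.C f) = alongLine c f := by
  simp [alongLine₂]

lemma alongLine₂_X (c : σ → ℂ) : alongLine₂ c Polynomial.X = Polynomial.X := by
  simp [alongLine₂]

lemma eval₂At_C (z : σ → ℂ) (t : ℂ) (f : MvPolynomial σ ℂ) :
    eval₂At z t (Polynomial.C f) = eval z f := by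
  simp [eval₂At]

lemma eval₂At_X (z : σ → ℂ) (t : ℂ) : eval₂At z t Polynomial.X = t := by
  simp [eval₂At]

lemma eval₂At_alongLine (c z : σ → ℂ) (t : ℂ) (f : MvPolynomial σ ℂ) :
    eval₂At z t (alongLine c f) = eval (c + t • z) f := by
  induction f using MvPolynomial.induction_on with
  | C a => rw [alongLine_C, eval₂At_C]; simp
  | add p q hp hq => simp only [map_add, hp, hq]
  | mul_X p i hp =>
    rw [map_mul, map_mul, map_mul, hp, alongLine_X, map_add, map_mul]
    simp [eval₂At_C, eval₂At_X]

lemma eval₂At_alongLine₂ (c z : σ → ℂ) (t : ℂ) (g : Polynomial (MvPolynomial σ ℂ)) :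
    eval₂At z t (alongLine₂ c g) = eval₂At (c + t • z) t g := by
  induction g using Polynomial.induction_on' with
  | add p q hp hq => simp only [map_add, hp, hq]
  | monomial n a =>
    rw [← Polynomial.C_mul_X_pow_eq_monomial]
    simp only [map_mul, map_pow, alongLine₂_C, alongLine₂_X, eval₂At_alongLine, eval₂At_C,
      eval₂At_X]

/-- For `t ≠ 0` the substitution `z ↦ c + t z` is a bijection with inverse `w ↦ (w - c) / t`, and
values at `t ≠ 0` determine a polynomial. -/
lemma alongLine₂_injective (c : σ → ℂ) : Function.Injective (alongLine₂ c) := by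
  rw [injective_iff_map_eq_zero]
  intro g hg
  have h1 : ∀ (w : σ → ℂ) (t : ℂ), t ≠ 0 → eval₂At w t g = 0 := by
    intro w t ht
    have := eval₂At_alongLine₂ c (t⁻¹ • (w - c)) t g
    rw [hg, map_zero, smul_inv_smul₀ ht, add_sub_cancel] at this
    exact this.symm
  have h2 : ∀ w : σ → ℂ, g.map (eval w) = 0 := by
    intro w
    have h3 : Polynomial.X * g.map (eval w) = 0 := by
      refine Polynomial.funext fun t => ?_
      rcases eq_or_ne t 0 with rfl | ht
      · simp
      · have := h1 w t ht
        simp only [eval₂At, Polynomial.coe_eval₂RingHom] at this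
        simp [Polynomial.eval_map, this]
    exact (mul_eq_zero.1 h3).resolve_left Polynomial.X_ne_zero
  ext1 n
  refine MvPolynomial.funext fun w => ?_
  have := congrArg (fun p => Polynomial.coeff p n) (h2 w)
  simpa using this

/-- The inverse substitution `z ↦ (z - c) / t` has only powers of `t` as denominators. With
injectivity, `alongLine₂ c` thus becomes an automorphism once `t` is inverted. -/
lemma exists_X_pow_mul_eq_alongLine₂ (c : σ → ℂ) (g : Polynomial (MvPolynomial σ ℂ)) :
    ∃ (N : ℕ) (h : Polynomial (MvPolynomial σ ℂ)), Polynomial.X ^ N * g = alongLine₂ c h := by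
  have hadd : ∀ g₁ g₂ : Polynomial (MvPolynomial σ ℂ),
      (∃ (N : ℕ) (h : _), Polynomial.X ^ N * g₁ = alongLine₂ c h) →
      (∃ (N : ℕ) (h : _), Polynomial.X ^ N * g₂ = alongLine₂ c h) →
      ∃ (N : ℕ) (h : _), Polynomial.X ^ N * (g₁ + g₂) = alongLine₂ c h := by
    rintro g₁ g₂ ⟨N₁, h₁, e₁⟩ ⟨N₂, h₂, e₂⟩
    refine ⟨N₁ + N₂, Polynomial.X ^ N₂ * h₁ + Polynomial.X ^ N₁ * h₂, ?_⟩
    simp only [map_add, map_mul, map_pow, alongLine₂_X, ← e₁, ← e₂]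
    ring
  have hmul : ∀ g₁ g₂ : Polynomial (MvPolynomial σ ℂ),
      (∃ (N : ℕ) (h : _), Polynomial.X ^ N * g₁ = alongLine₂ c h) →
      (∃ (N : ℕ) (h : _), Polynomial.X ^ N * g₂ = alongLine₂ c h) →
      ∃ (N : ℕ) (h : _), Polynomial.X ^ N * (g₁ * g₂) = alongLine₂ c h := by
    rintro g₁ g₂ ⟨N₁, h₁, e₁⟩ ⟨N₂, h₂, e₂⟩
    refine ⟨N₁ + N₂, h₁ * h₂, ?_⟩
    simp only [map_mul, ← e₁, ← e₂]
    ring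
  have hC : ∀ f : MvPolynomial σ ℂ, ∃ (N : ℕ) (h : _),
      Polynomial.X ^ N * Polynomial.C f = alongLine₂ c h := by
    intro f
    induction f using MvPolynomial.induction_on with
    | C a => exact ⟨0, Polynomial.C (C a), by rw [alongLine₂_C, alongLine_C]; simp⟩
    | add p q hp hq => rw [map_add]; exact hadd _ _ hp hq
    | mul_X p i hp =>
      rw [map_mul]
      refine hmul _ _ hp ⟨1, Polynomial.C (X i) - Polynomial.C (C (c i)), ?_⟩
      rw [map_sub, alongLine₂_C, alongLine₂_C, alongLine_X, alongLine_C]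
      ring
  induction g using Polynomial.induction_on' with
  | add p q hp hq => exact hadd _ _ hp hq
  | monomial n a =>
    rw [← Polynomial.C_mul_X_pow_eq_monomial]
    refine hmul _ _ (hC a) ⟨0, Polynomial.X ^ n, ?_⟩
    rw [map_pow, alongLine₂_X]; simp

lemma coeff_zero_alongLine (c : σ → ℂ) (f : MvPolynomial σ ℂ) :
    (alongLine c f).coeff 0 = C (eval c f) := by
  induction f using MvPolynomial.induction_on with
  | C a => rw [alongLine_C]; simp
  | add p q hp hq => simp only [map_add, Polynomial.coeff_add, hp, hq]
  | mul_X p i hp => rw [map_mul, Polynomial.mul_coeff_zero, hp, alongLine_X]; simp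

variable {c : σ → ℂ} {q : MvPolynomial σ ℂ}

/-- The constant term of `q (c + t z)` in `t` is `q c ≠ 0`, so the prime `t` does not divide it and
powers of `t` can be dropped. -/
lemma dvd_of_alongLine_dvd_X_pow_mul (hc : eval c q ≠ 0) {N : ℕ}
    {g : Polynomial (MvPolynomial σ ℂ)} (h : alongLine c q ∣ Polynomial.X ^ N * g) :
    alongLine c q ∣ g := by
  have hX : ¬ (Polynomial.X : Polynomial (MvPolynomial σ ℂ)) ∣ alongLine c q := by
    rw [Polynomial.X_dvd_iff, coeff_zero_alongLine]
    simpa using hc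
  have : IsRelPrime (Polynomial.X : Polynomial (MvPolynomial σ ℂ)) (alongLine c q) :=
    Polynomial.prime_X.irreducible.isRelPrime_iff_not_dvd.2 hX
  exact (this.symm.pow_right (n := N)).dvd_of_dvd_mul_left h

lemma C_dvd_of_dvd_X_pow_mul (hq : Irreducible q) {N : ℕ}
    {g : Polynomial (MvPolynomial σ ℂ)} (h : Polynomial.C q ∣ Polynomial.X ^ N * g) :
    Polynomial.C q ∣ g := by
  have hp : Prime (Polynomial.C q) := Polynomial.prime_C_iff.2 hq.prime
  rcases hp.dvd_or_dvd h with h | h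
  · have h1 := (Polynomial.C_dvd_iff_dvd_coeff _ _).1 (hp.dvd_of_dvd_pow h) 1
    rw [Polynomial.coeff_X_one] at h1
    exact absurd (isUnit_of_dvd_one h1) hq.not_isUnit
  · exact h

/-- Irreducibility is transported through the automorphism obtained by inverting `t`; the powers of
`t` that this costs are removed by the two preceding divisibility lemmas. -/
lemma irreducible_alongLine (hq : Irreducible q) (hc : eval c q ≠ 0) :
    Irreducible (alongLine c q) := by
  have hp : Prime (Polynomial.C q) := Polynomial.prime_C_iff.2 hq.prime
  have key : ∀ G G' : Polynomial (MvPolynomial σ ℂ), alongLine c q = G * G' →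
      alongLine c q ∣ G ∨ alongLine c q ∣ G' := by
    intro G G' hG
    obtain ⟨N, h, e⟩ := exists_X_pow_mul_eq_alongLine₂ c G
    obtain ⟨N', h', e'⟩ := exists_X_pow_mul_eq_alongLine₂ c G'
    have h1 : Polynomial.X ^ (N + N') * Polynomial.C q = h * h' := by
      apply alongLine₂_injective c
      rw [map_mul, map_mul, map_pow, alongLine₂_X, alongLine₂_C, hG, ← e, ← e']
      ring
    rcases hp.dvd_or_dvd (Dvd.intro_left _ h1) with ⟨k, hk⟩ | ⟨k, hk⟩
    · left
      refine dvd_of_alongLine_dvd_X_pow_mul (N := N) hc ?_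
      rw [e, hk, map_mul, alongLine₂_C]
      exact dvd_mul_right _ _
    · right
      refine dvd_of_alongLine_dvd_X_pow_mul (N := N') hc ?_
      rw [e', hk, map_mul, alongLine₂_C]
      exact dvd_mul_right _ _
  have hne : alongLine c q ≠ 0 := by
    intro h
    have := coeff_zero_alongLine c q
    rw [h] at this
    rw [Polynomial.coeff_zero, eq_comm, map_eq_zero_iff _ (C_injective σ ℂ)] at this
    exact hc this
  refine ⟨?_, ?_⟩
  · intro hu
    obtain ⟨G, hG⟩ := hu.exists_right_inv
    obtain ⟨N, h, e⟩ := exists_X_pow_mul_eq_alongLine₂ c G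
    have h1 : Polynomial.C q * h = Polynomial.X ^ N * 1 := by
      apply alongLine₂_injective c
      rw [map_mul, map_mul, map_pow, alongLine₂_X, alongLine₂_C, ← e, map_one]
      linear_combination Polynomial.X ^ N * hG
    have h2 := C_dvd_of_dvd_X_pow_mul hq (Dvd.intro _ h1)
    exact hp.not_isUnit (isUnit_of_dvd_one h2)
  · intro G G' hG
    rcases key G G' hG with ⟨u, hu⟩ | ⟨u, hu⟩
    · right
      refine IsUnit.of_mul_eq_one u ?_
      apply mul_left_cancel₀ hne
      calc alongLine c q * (G' * u) = (alongLine c q * u) * G' := by ring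
        _ = alongLine c q * 1 := by rw [← hu, ← hG, mul_one]
    · left
      refine IsUnit.of_mul_eq_one u ?_
      apply mul_left_cancel₀ hne
      calc alongLine c q * (G * u) = G * (alongLine c q * u) := by ring
        _ = alongLine c q * 1 := by rw [← hu, ← hG, mul_one]

lemma alongLine_dvd_alongLine (hq : Irreducible q) {A : MvPolynomial σ ℂ}
    (h : alongLine c q ∣ alongLine c A) : q ∣ A := by
  obtain ⟨G, hG⟩ := h
  obtain ⟨N, h, e⟩ := exists_X_pow_mul_eq_alongLine₂ c G
  have h1 : Polynomial.X ^ N * Polynomial.C A = Polynomial.C q * h := by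
    apply alongLine₂_injective c
    rw [map_mul, map_mul, map_pow, alongLine₂_X, alongLine₂_C, alongLine₂_C, ← e, hG]
    ring
  have h2 := C_dvd_of_dvd_X_pow_mul hq (Dvd.intro _ h1.symm)
  have := (Polynomial.C_dvd_iff_dvd_coeff _ _).1 h2 0
  simpa using this

/-- By Gauss's lemma `p` stays irreducible, and still does not divide `a`, over the fraction field.
There Bézout's identity holds, and `r` is the product of the denominators cleared from its
coefficients. -/
lemma exists_bezout_of_irreducible {R : Type*} [CommRing R] [IsDomain R]
    [UniqueFactorizationMonoid R] {p a : Polynomial R} (hp : Irreducible p)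
    (hdeg : p.natDegree ≠ 0) (hpa : ¬ p ∣ a) :
    ∃ (r : R) (u v : Polynomial R), r ≠ 0 ∧ u * a + v * p = Polynomial.C r := by
  classical
  let _ : NormalizedGCDMonoid R := Classical.choice inferInstance
  have hprim := hp.isPrimitive hdeg
  let K := FractionRing R
  have hirr := (hprim.irreducible_iff_irreducible_map_fraction_map (K := K)).1 hp
  have hnd : ¬ p.map (algebraMap R K) ∣ a.map (algebraMap R K) := fun h =>
    hpa (hprim.dvd_of_fraction_map_dvd_fraction_map h)
  obtain ⟨v, u, huv⟩ := (hirr.coprime_iff_not_dvd).2 hnd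
  obtain ⟨b₁, hb₁, hu⟩ := IsLocalization.integerNormalization_spec (nonZeroDivisors R) u
  obtain ⟨b₂, hb₂, hv⟩ := IsLocalization.integerNormalization_spec (nonZeroDivisors R) v
  refine ⟨b₁ * b₂, Polynomial.C b₂ * IsLocalization.integerNormalization (nonZeroDivisors R) u,
    Polynomial.C b₁ * IsLocalization.integerNormalization (nonZeroDivisors R) v,
    mul_ne_zero (nonZeroDivisors.ne_zero hb₁) (nonZeroDivisors.ne_zero hb₂), ?_⟩
  apply Polynomial.map_injective _ (IsFractionRing.injective R K)
  simp only [Polynomial.map_add, Polynomial.map_mul, Polynomial.map_C, hu, hv]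
  simp only [Algebra.smul_def, Polynomial.algebraMap_apply, map_mul]
  linear_combination (Polynomial.C (algebraMap R K b₁) * Polynomial.C (algebraMap R K b₂)) * huv

/-- Elimination along lines through `c`: the `z` for which a polynomial `A` and an irreducible `q`
that does not divide it have a common zero on the line `c + t z` are zeros of a nonzero
polynomial. -/
lemma exists_elimination (hq : Irreducible q) (hc : eval c q ≠ 0) {A : MvPolynomial σ ℂ}
    (hA : ¬ q ∣ A) : ∃ R : MvPolynomial σ ℂ, R ≠ 0 ∧
      ∀ (z : σ → ℂ) (t : ℂ), eval (c + t • z) q = 0 → eval (c + t • z) A = 0 → eval z R = 0 := by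
  have hirr := irreducible_alongLine hq hc
  have hdeg : (alongLine c q).natDegree ≠ 0 := by
    intro h
    have h1 := Polynomial.eq_C_of_natDegree_eq_zero h
    rw [coeff_zero_alongLine] at h1
    apply hirr.not_isUnit
    rw [h1, Polynomial.isUnit_C]
    exact (isUnit_iff_ne_zero.2 hc).map C
  obtain ⟨R, u, v, hR, huv⟩ := exists_bezout_of_irreducible hirr hdeg
    (fun h => hA (alongLine_dvd_alongLine hq h))
  refine ⟨R, hR, fun z t h1 h2 => ?_⟩
  have := congrArg (eval₂At z t) huv
  rw [map_add, map_mul, map_mul, eval₂At_alongLine, eval₂At_alongLine, h1, h2, eval₂At_C] at this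
  simpa using this.symm

end Elimination

lemma eval_aeval_polynomial {σ : Type*} (g : σ → Polynomial ℂ) (a : MvPolynomial σ ℂ) (t : ℂ) :
    (aeval g a).eval t = eval (fun i => (g i).eval t) a := by
  induction a using MvPolynomial.induction_on with
  | C a => simp
  | add p q hp hq => simp only [map_add, Polynomial.eval_add, hp, hq]
  | mul_X p i hp => simp [hp]

lemma exists_irreducible_factor_eval_eq_zero {σ : Type*} {B : MvPolynomial σ ℂ} (hB : B ≠ 0)
    {z : σ → ℂ} (hz : eval z B = 0) : ∃ q, Irreducible q ∧ q ∣ B ∧ eval z q = 0 := by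
  revert hB hz
  refine WfDvdMonoid.induction_on_irreducible B (fun h => absurd rfl h) ?_ ?_
  · intro u hu _ hz
    exact absurd hz (hu.map (eval z)).ne_zero
  · intro a i ha hi ih _ hz
    rw [map_mul, mul_eq_zero] at hz
    rcases hz with hz | hz
    · exact ⟨i, hi, dvd_mul_right _ _, hz⟩
    · obtain ⟨q, hq, hqa, hqz⟩ := ih ha hz
      exact ⟨q, hq, hqa.mul_left _, hqz⟩

lemma continuous_eval_add_smul {d : ℕ} (c : Fin d → ℂ) (q : MvPolynomial (Fin d) ℂ) :
    Continuous fun p : (Fin d → ℂ) × ℂ => eval (c + p.2 • p.1) q :=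
  (differentiable_eval q).continuous.comp (by fun_prop)

lemma differentiable_eval_add_smul {d : ℕ} (c z : Fin d → ℂ) (q : MvPolynomial (Fin d) ℂ) :
    Differentiable ℂ fun t : ℂ => eval (c + t • z) q :=
  (differentiable_eval q).comp (by fun_prop)

/-! ### Reduced fractions on the polydisc, and their symmetry. -/

/-- If `A` vanishes at the zeros of `B` in the polydisc and is relatively prime to `B`, then `B`
has no zeros in the polydisc. -/
lemma eval_ne_zero_of_isRelPrime {d : ℕ} {A B : MvPolynomial (Fin d) ℂ} (hAB : IsRelPrime A B)
    (hB : B ≠ 0) (h : ∀ z ∈ polydisc d, eval z B = 0 → eval z A = 0) :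
    ∀ z ∈ polydisc d, eval z B ≠ 0 := by
  intro z₀ hz₀ hz
  obtain ⟨c, hc⟩ : ∃ c, eval c B ≠ 0 := by
    by_contra! hno
    exact hB (MvPolynomial.funext fun x => by simp [hno x])
  obtain ⟨q, hq, ⟨k, rfl⟩, hqz⟩ := exists_irreducible_factor_eval_eq_zero hB hz
  rw [map_mul] at hc
  have hqA : ¬ q ∣ A := fun hdvd => hq.not_isUnit (hAB hdvd (dvd_mul_right _ _))
  obtain ⟨R, hR, hel⟩ := exists_elimination hq (left_ne_zero_of_mul hc) hqA
  -- The line `c + t (z₀ - c)` meets the zero `z₀` of `q` at `t = 1`. For every direction near `z₀ -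
  -- c` a zero of `q` remains near `t = 1`, still in the polydisc, hence also a zero of `A`; so `R`
  -- vanishes on an open set.
  refine hR (eq_zero_of_eventually_eval_eq_zero (z₀ := z₀ - c) ?_)
  have hmem : ∀ᶠ p : (Fin d → ℂ) × ℂ in 𝓝 (z₀ - c, 1), c + p.2 • p.1 ∈ polydisc d := by
    have hcont : Continuous fun p : (Fin d → ℂ) × ℂ => c + p.2 • p.1 := by fun_prop
    exact hcont.continuousAt.eventually ((isOpen_polydisc d).mem_nhds (by simpa using hz₀))
  rw [nhds_prod_eq, eventually_prod_iff] at hmem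
  obtain ⟨pa, hpa, pb, hpb, hpab⟩ := hmem
  obtain ⟨ε, hε, hball⟩ := Metric.eventually_nhds_iff_ball.1 hpb
  filter_upwards [hpa, eventually_exists_zero_near (φ := fun z t => eval (c + t • z) q)
    (continuous_eval_add_smul c q) (fun z => differentiable_eval_add_smul c z q)
    (x₀ := z₀ - c) (t₀ := 1) (t₁ := 0) (by simpa using hqz)
    (by simpa using left_ne_zero_of_mul hc) hε] with z hz ⟨t, ht, hzt⟩
  exact hel z t hzt (h _ (hpab hz (hball t ht)) (by rw [map_mul, hzt, zero_mul]))

lemma isUnit_iff_exists_C {σ : Type*} {u : MvPolynomial σ ℂ} (hu : IsUnit u) :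
    ∃ r : ℂ, r ≠ 0 ∧ u = C r := by
  obtain ⟨r, hr, h⟩ := MvPolynomial.isUnit_iff_eq_C_of_isReduced.1 hu
  exact ⟨r, hr.ne_zero, h⟩

/-- A function on the symmetrized polydisc that is a quotient of polynomials on the polydisc is a
quotient of relatively prime polynomials without poles. -/
lemma exists_isRelPrime_mul_eq {d : ℕ} {f : (Fin d → ℂ) → ℂ} (hf : ContinuousOn f (symPolydisc d))
    {A B : MvPolynomial (Fin d) ℂ} (hB : B ≠ 0)
    (h : ∀ z ∈ polydisc d, f (symmetrization d z) * eval z B = eval z A) :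
    ∃ a b : MvPolynomial (Fin d) ℂ, IsRelPrime (pullback d a) (pullback d b) ∧ IsRelPrime a b ∧
      (∀ x ∈ symPolydisc d, eval x b ≠ 0) ∧ ∀ x ∈ symPolydisc d, f x * eval x b = eval x a := by
  obtain ⟨A₀, B₀, g, hAB, rfl, rfl⟩ := UniqueFactorizationMonoid.exists_reduced_factors' A B hB
  have hg : g ≠ 0 := left_ne_zero_of_mul hB
  have hB₀ : B₀ ≠ 0 := right_ne_zero_of_mul hB
  have hFc : ContinuousOn (fun z => f (symmetrization d z)) (polydisc d) :=
    hf.comp (continuous_symmetrization d).continuousOn fun z hz => ⟨z, hz, rfl⟩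
  -- The common factor `g` may be cancelled: near a point where the reduced identity fails it fails
  -- by continuity, so `g` would vanish on an open set.
  have h0 : ∀ z ∈ polydisc d, f (symmetrization d z) * eval z B₀ = eval z A₀ := by
    intro z₀ hz₀
    by_contra hne
    have hcont : ContinuousAt (fun z => f (symmetrization d z) * eval z B₀ - eval z A₀) z₀ :=
      ((hFc.continuousAt ((isOpen_polydisc d).mem_nhds hz₀)).mul
        (differentiable_eval B₀).continuous.continuousAt).sub
        (differentiable_eval A₀).continuous.continuousAt
    refine hg (eq_zero_of_eventually_eval_eq_zero (z₀ := z₀) ?_)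
    filter_upwards [hcont.eventually_ne (sub_ne_zero.2 hne),
      (isOpen_polydisc d).mem_nhds hz₀] with z hz hzD
    have := h z hzD
    rw [map_mul, map_mul] at this
    have h2 : eval z g * (f (symmetrization d z) * eval z B₀ - eval z A₀) = 0 := by
      linear_combination this
    exact (mul_eq_zero.1 h2).resolve_right hz
  have hne := eval_ne_zero_of_isRelPrime hAB hB₀ fun z hz hzB => by rw [← h0 z hz, hzB, mul_zero]
  -- A permutation of the variables leaves the function unchanged, so it yields another
  -- representation of the same fraction.
  have hperm : ∀ σ : Equiv.Perm (Fin d), rename σ A₀ * B₀ = A₀ * rename σ B₀ := by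
    intro σ
    rw [← sub_eq_zero]
    refine eq_zero_of_eval_eq_zero_on_polydisc fun z hz => ?_
    have h1 := h0 z hz
    have h2 := h0 (z ∘ σ) fun i => hz (σ i)
    rw [symmetrization_comp_perm] at h2
    simp only [map_sub, map_mul, eval_rename]
    rw [← h1, ← h2]; ring
  have hBs : B₀.IsSymmetric := by
    intro σ
    obtain ⟨u, hu⟩ : B₀ ∣ rename σ B₀ :=
      hAB.symm.dvd_of_dvd_mul_left (Dvd.intro_left _ (hperm σ))
    have hσB : rename σ B₀ ≠ 0 := by
      rw [Ne, map_eq_zero_iff _ (rename_injective σ σ.injective)]; exact hB₀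
    have hu0 : u ≠ 0 := by rintro rfl; exact hσB (by rw [hu, mul_zero])
    -- Permuting variables preserves the degree, so `u` is constant; the origin is fixed by all
    -- permutations and `B₀ 0 ≠ 0`, so the constant is `1`.
    have hdeg : u.totalDegree = 0 := by
      have h1 := totalDegree_mul_of_isDomain hB₀ hu0
      rw [← hu, show (rename σ B₀).totalDegree = B₀.totalDegree from
        totalDegree_renameEquiv σ B₀] at h1
      omega
    rw [totalDegree_eq_zero_iff_eq_C] at hdeg
    have h2 := congrArg (eval 0) hu
    rw [hdeg, map_mul, eval_rename, eval_C] at h2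
    have h3 : coeff 0 u = 1 := by
      have := hne 0 (zero_mem_polydisc d)
      refine mul_left_cancel₀ this ?_
      rw [← h2, mul_one]; rfl
    rw [hu, hdeg, h3, C_1, mul_one]
  have hAs : A₀.IsSymmetric := by
    intro σ
    have := hperm σ
    rw [hBs σ] at this
    exact mul_right_cancel₀ hB₀ this
  obtain ⟨a, rfl⟩ := exists_pullback_eq hAs
  obtain ⟨b, rfl⟩ := exists_pullback_eq hBs
  -- Coprimality of the pullbacks implies that of `a` and `b`. The former serves for elimination
  -- near the torus, the latter for the reflection argument.
  refine ⟨a, b, hAB, ?_, ?_, ?_⟩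
  · rintro e ⟨a', rfl⟩ ⟨b', rfl⟩
    have hu := hAB (d := pullback d e) (by rw [map_mul]; exact dvd_mul_right _ _)
      (by rw [map_mul]; exact dvd_mul_right _ _)
    obtain ⟨r, hr, hre⟩ := isUnit_iff_exists_C hu
    have : e = C r := pullback_injective d (by rw [hre]; simp)
    rw [this]
    exact (isUnit_iff_ne_zero.2 hr).map C
  · rintro _ ⟨z, hz, rfl⟩
    rw [← eval_pullback]
    exact hne z hz
  · rintro _ ⟨z, hz, rfl⟩
    rw [← eval_pullback, ← eval_pullback]
    exact h0 z hz

/-! ### Reflection in the symmetrized torus, and the relation between numerator and denominator. -/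

section Reflection

variable {n : ℕ}

lemma reflection_last (x : Fin (n + 1) → ℂ) :
    reflection x (Fin.last n) = 1 / conj (x (Fin.last n)) := by
  simp [reflection]

lemma reflection_castSucc (x : Fin (n + 1) → ℂ) (j : Fin n) :
    reflection x j.castSucc = conj (x j.rev.castSucc) / conj (x (Fin.last n)) := by
  simp [reflection]

lemma reflection_reflection {x : Fin (n + 1) → ℂ} (hx : x (Fin.last n) ≠ 0) :
    reflection (reflection x) = x := by
  ext i
  refine Fin.lastCases ?_ (fun j => ?_) i
  · simp [reflection_last]
  · rw [reflection_castSucc, reflection_castSucc, reflection_last]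
    simp [hx]

lemma symmetrization_last (z : Fin (n + 1) → ℂ) :
    symmetrization (n + 1) z (Fin.last n) = ∏ i, z i := by
  have h : Finset.powersetCard (n + 1) (Finset.univ : Finset (Fin (n + 1))) = {Finset.univ} := by
    have := Finset.powersetCard_self (Finset.univ : Finset (Fin (n + 1)))
    rwa [Finset.card_univ, Fintype.card_fin] at this
  simp [symmetrization, h]

/-- Reflection is the image of `z ↦ 1 / conj z`. Passing to complements of index sets exchanges the
elementary symmetric polynomials of degrees `j + 1` and `n - j` up to the factor `∏ z i`. -/
lemma reflection_symmetrization {z : Fin (n + 1) → ℂ} (hz : ∀ i, z i ≠ 0) :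
    reflection (symmetrization (n + 1) z) = symmetrization (n + 1) fun i => 1 / conj (z i) := by
  ext i
  refine Fin.lastCases ?_ (fun j => ?_) i
  · simp [reflection_last, symmetrization_last, map_prod]
  · rw [reflection_castSucc, symmetrization_last]
    simp only [symmetrization, map_sum, map_prod, Finset.sum_div]
    refine Finset.sum_nbij' (fun t => tᶜ) (fun t => tᶜ) ?_ ?_ (fun t _ => compl_compl t)
      (fun t _ => compl_compl t) ?_
    · intro t ht
      rw [Finset.mem_powersetCard_univ] at ht ⊢
      rw [Finset.card_compl, ht, Fintype.card_fin]
      simp; omega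
    · intro t ht
      rw [Finset.mem_powersetCard_univ] at ht ⊢
      rw [Finset.card_compl, ht, Fintype.card_fin]
      simp; omega
    · intro t _
      have hne : ∏ i ∈ t, conj (z i) ≠ 0 :=
        Finset.prod_ne_zero_iff.2 fun i _ => by simpa using hz i
      rw [← Finset.prod_mul_prod_compl t (fun i => conj (z i))]
      simp only [one_div, Finset.prod_inv_distrib]
      rw [div_mul_eq_div_div, div_self hne, one_div]

lemma one_div_conj_of_norm_eq_one {a : ℂ} (h : ‖a‖ = 1) : 1 / conj a = a := by
  have h0 : a ≠ 0 := by rintro rfl; simp at h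
  have h1 : a * conj a = 1 := by rw [Complex.mul_conj']; simp [h]
  have h2 : conj a ≠ 0 := by simpa using h0
  rw [div_eq_iff h2, h1]

lemma reflection_symmetrization_of_mem_torus {ζ : Fin (n + 1) → ℂ} (hζ : ζ ∈ torus (n + 1)) :
    reflection (symmetrization (n + 1) ζ) = symmetrization (n + 1) ζ := by
  rw [reflection_symmetrization fun i h => by have := hζ i; simp [h] at this]
  congr 1
  ext i
  exact one_div_conj_of_norm_eq_one (hζ i)

lemma norm_symmetrization_last_of_mem_torus {ζ : Fin (n + 1) → ℂ} (hζ : ζ ∈ torus (n + 1)) :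
    ‖symmetrization (n + 1) ζ (Fin.last n)‖ = 1 := by
  rw [symmetrization_last, norm_prod]
  exact Finset.prod_eq_one fun i _ => hζ i

/-- Each variable contributes at most one factor `1 / p` after reflection and conjugation, so a
power of `p` clears the denominators. -/
lemma exists_reflected_polynomial (a : MvPolynomial (Fin (n + 1)) ℂ) :
    ∃ (N : ℕ) (A : MvPolynomial (Fin (n + 1)) ℂ), ∀ x : Fin (n + 1) → ℂ, x (Fin.last n) ≠ 0 →
      eval x A = x (Fin.last n) ^ N * conj (eval (reflection x) a) := by
  induction a using MvPolynomial.induction_on with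
  | C r => exact ⟨0, C (conj r), fun x _ => by simp⟩
  | add p q hp hq =>
    obtain ⟨N, P, hP⟩ := hp
    obtain ⟨M, Q, hQ⟩ := hq
    refine ⟨N + M, X (Fin.last n) ^ M * P + X (Fin.last n) ^ N * Q, fun x hx => ?_⟩
    simp only [map_add, map_mul, map_pow, eval_X, hP x hx, hQ x hx]
    ring
  | mul_X p i hp =>
    obtain ⟨N, P, hP⟩ := hp
    refine Fin.lastCases ?_ (fun j => ?_) i
    · refine ⟨N + 1, P, fun x hx => ?_⟩
      rw [hP x hx, map_mul, eval_X, reflection_last, map_mul, map_div₀, Complex.conj_conj, map_one]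
      field_simp
      ring
    · refine ⟨N + 1, P * X j.rev.castSucc, fun x hx => ?_⟩
      rw [map_mul, eval_X, hP x hx, map_mul, eval_X, reflection_castSucc, map_mul, map_div₀,
        Complex.conj_conj, Complex.conj_conj]
      field_simp
      ring

lemma eq_of_eval_eq_of_last_ne_zero {P Q : MvPolynomial (Fin (n + 1)) ℂ}
    (h : ∀ x : Fin (n + 1) → ℂ, x (Fin.last n) ≠ 0 → eval x P = eval x Q) : P = Q := by
  have h1 : X (Fin.last n) * P = X (Fin.last n) * Q := by
    refine MvPolynomial.funext fun x => ?_
    rw [map_mul, map_mul, eval_X]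
    rcases eq_or_ne (x (Fin.last n)) 0 with h0 | h0
    · rw [h0, zero_mul, zero_mul]
    · rw [h x h0]
  exact mul_left_cancel₀ (X_ne_zero _) h1

lemma eq_of_eval_symmetrization_eq_on_torus {P Q : MvPolynomial (Fin (n + 1)) ℂ}
    (h : ∀ ζ ∈ torus (n + 1), eval (symmetrization (n + 1) ζ) P = eval (symmetrization (n + 1) ζ) Q) :
    P = Q := by
  refine pullback_injective (n + 1) (sub_eq_zero.1 (eq_zero_of_eval_eq_zero_on_torus fun ζ hζ => ?_))
  rw [map_sub, eval_pullback, eval_pullback, h ζ hζ, sub_self]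

/-- Two polynomials of the same modulus on the distinguished boundary: the numerator is the
reflection of the denominator when they are relatively prime. -/
lemma exists_eval_eq_reflection {a b : MvPolynomial (Fin (n + 1)) ℂ} (hab : IsRelPrime a b)
    (h0 : eval 0 b ≠ 0)
    (hT : ∀ ζ ∈ torus (n + 1), ‖eval (symmetrization (n + 1) ζ) a‖ =
      ‖eval (symmetrization (n + 1) ζ) b‖) :
    ∃ (k : ℕ) (τ : ℂ), ‖τ‖ = 1 ∧ ∀ x : Fin (n + 1) → ℂ, x (Fin.last n) ≠ 0 →
      eval x a = τ * x (Fin.last n) ^ k * conj (eval (reflection x) b) := by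
  have hb : b ≠ 0 := by rintro rfl; simp at h0
  obtain ⟨Na, a₁, ha₁⟩ := exists_reflected_polynomial a
  obtain ⟨Nb, b₁, hb₁⟩ := exists_reflected_polynomial b
  obtain ⟨N, as, bs, has, hbs⟩ : ∃ (N : ℕ) (as bs : MvPolynomial (Fin (n + 1)) ℂ),
      (∀ x : Fin (n + 1) → ℂ, x (Fin.last n) ≠ 0 →
        eval x as = x (Fin.last n) ^ N * conj (eval (reflection x) a)) ∧
      (∀ x : Fin (n + 1) → ℂ, x (Fin.last n) ≠ 0 →
        eval x bs = x (Fin.last n) ^ N * conj (eval (reflection x) b)) := by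
    refine ⟨Na + Nb, X (Fin.last n) ^ Nb * a₁, X (Fin.last n) ^ Na * b₁, fun x hx => ?_,
      fun x hx => ?_⟩
    · rw [map_mul, map_pow, eval_X, ha₁ x hx]; ring
    · rw [map_mul, map_pow, eval_X, hb₁ x hx]; ring
  -- On the symmetrized torus reflection is the identity, and the two sides are `p^N |a|²` and `p^N
  -- |b|²`.
  have hmul : a * as = b * bs := by
    refine eq_of_eval_symmetrization_eq_on_torus fun ζ hζ => ?_
    have hp : symmetrization (n + 1) ζ (Fin.last n) ≠ 0 := by
      rw [← norm_ne_zero_iff, norm_symmetrization_last_of_mem_torus hζ]; exact one_ne_zero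
    rw [map_mul, map_mul, has _ hp, hbs _ hp, reflection_symmetrization_of_mem_torus hζ]
    rw [mul_left_comm, mul_left_comm (eval _ b), Complex.mul_conj', Complex.mul_conj', hT ζ hζ]
  obtain ⟨c, hc⟩ : b ∣ as := hab.symm.dvd_of_dvd_mul_left (Dvd.intro _ hmul.symm)
  have hc' : bs = a * c := by
    refine mul_left_cancel₀ hb ?_
    rw [← hmul, hc]; ring
  obtain ⟨M, c₁, hc₁⟩ := exists_reflected_polynomial c
  -- Reflecting `b* = a c` and inserting `a* = b c` shows that `c` times its own reflection is `1`.
  -- Hence `c` divides a power of the prime `p` and is itself such a power up to a constant.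
  have hcc : c * c₁ = X (Fin.last n) ^ M := by
    refine mul_left_cancel₀ hb (eq_of_eval_eq_of_last_ne_zero fun x hx => ?_)
    have hx' : reflection x (Fin.last n) ≠ 0 := by rw [reflection_last]; simpa using hx
    have e1 := has x hx
    have e2 := hbs _ hx'
    rw [hc, map_mul] at e1
    rw [hc', map_mul, reflection_reflection hx, reflection_last] at e2
    have e3 := congrArg conj e2
    simp only [map_mul, map_pow, map_div₀, map_one, Complex.conj_conj] at e3
    rw [map_mul, map_mul, map_mul, map_pow, eval_X, hc₁ x hx]
    have hpN : x (Fin.last n) ^ N * (1 / x (Fin.last n)) ^ N = 1 := by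
      rw [← mul_pow, mul_one_div_cancel hx, one_pow]
    linear_combination (x (Fin.last n) ^ M * conj (eval (reflection x) c)) * e1 +
      x (Fin.last n) ^ M * x (Fin.last n) ^ N * e3 + x (Fin.last n) ^ M * eval x b * hpN
  obtain ⟨j, -, v, hv⟩ := (dvd_prime_pow (X_prime (i := Fin.last n)) M).1 (Dvd.intro _ hcc)
  obtain ⟨u, hu0, hu⟩ : ∃ u : ℂ, u ≠ 0 ∧ C u * c = X (Fin.last n) ^ j := by
    obtain ⟨u, hu0, hu⟩ := isUnit_iff_exists_C v.isUnit
    exact ⟨u, hu0, by rw [← hv, hu, mul_comm]⟩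
  -- Both relations for `c` are evaluated at the point with all coordinates `1` and at its
  -- reflection, where `p = 1`.
  have hu1 : ‖u‖ = 1 := by
    have hx : (fun _ => 1 : Fin (n + 1) → ℂ) (Fin.last n) ≠ 0 := one_ne_zero
    have e1 := congrArg (eval fun _ => 1) hcc
    have e2 := congrArg (eval fun _ => 1) hu
    have e3 := congrArg (eval (reflection fun _ => 1)) hu
    rw [map_mul, hc₁ _ hx] at e1
    rw [map_mul, map_pow, eval_X, eval_C] at e2 e3
    rw [reflection_last] at e3
    simp only [map_pow, eval_X, one_pow, one_mul, map_one, div_one] at e1 e2 e3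
    have e4 := congrArg conj e3
    rw [map_mul, map_one] at e4
    have e5 : u * conj u = 1 := by
      linear_combination e2 * conj u * conj (eval (reflection fun _ => 1) c) + e4 -
        u * conj u * e1
    rw [Complex.mul_conj'] at e5
    have e6 : ‖u‖ ^ 2 = 1 := by exact_mod_cast e5
    exact (pow_eq_one_iff_of_nonneg (norm_nonneg u) two_ne_zero).1 e6
  have hrel : ∀ x : Fin (n + 1) → ℂ, x (Fin.last n) ≠ 0 →
      x (Fin.last n) ^ j * eval x a =
        u * (x (Fin.last n) ^ N * conj (eval (reflection x) b)) := by
    intro x hx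
    have e2 := congrArg (eval x) hu
    rw [map_mul, map_pow, eval_X, eval_C] at e2
    rw [← hbs x hx, hc', map_mul, ← e2]; ring
  -- Otherwise, on the axis where only `p` is nonzero, `p^(j - N) a` is a nonconstant polynomial in
  -- `p`; but it equals `u` times the conjugate of `b` at `1 / conj p`, which tends to the finite
  -- nonzero value `u * conj (b 0)` as `p → ∞`. The variable `s` below is `1 / p`.
  have hjN : j ≤ N := by
    by_contra! hlt
    set α : Polynomial ℂ := Polynomial.X ^ (j - N) *
      aeval (Pi.single (Fin.last n) Polynomial.X : Fin (n + 1) → Polynomial ℂ) a with hα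
    have hsing : ∀ t : ℂ, (fun i => ((Pi.single (Fin.last n) Polynomial.X :
        Fin (n + 1) → Polynomial ℂ) i).eval t) = Pi.single (Fin.last n) t := by
      intro t
      ext i
      by_cases hi : i = Fin.last n
      · subst hi; simp
      · simp [Pi.single_eq_of_ne hi]
    have hrefl : ∀ t : ℂ, reflection (Pi.single (Fin.last n) t) =
        Pi.single (Fin.last n) (1 / conj t) := by
      intro t
      ext i
      refine Fin.lastCases ?_ (fun i => ?_) i
      · simp [reflection_last]
      · rw [reflection_castSucc]
        simp
    have hval : ∀ s : ℂ, s ≠ 0 → α.eval s⁻¹ =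
        u * conj (eval (Pi.single (Fin.last n) (conj s)) b) := by
      intro s hs
      have e := hrel (Pi.single (Fin.last n) s⁻¹) (by simpa using hs)
      rw [hrefl] at e
      simp only [Pi.single_eq_same, map_inv₀, one_div, inv_inv] at e
      rw [hα, Polynomial.eval_mul, Polynomial.eval_pow, Polynomial.eval_X, eval_aeval_polynomial,
        hsing]
      have hsN : s⁻¹ ^ N ≠ 0 := pow_ne_zero _ (inv_ne_zero hs)
      refine mul_left_cancel₀ hsN ?_
      rw [← mul_assoc, ← pow_add, Nat.add_sub_cancel' hlt.le, e]; ring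
    have hlim : Tendsto (fun s : ℂ => u * conj (eval (Pi.single (Fin.last n) (conj s)) b))
        (𝓝[≠] 0) (𝓝 (u * conj (eval 0 b))) := by
      have hcont : Continuous fun s : ℂ =>
          u * conj (eval (Pi.single (Fin.last n) (conj s)) b) := by
        refine continuous_const.mul (Complex.continuous_conj.comp ?_)
        refine (differentiable_eval b).continuous.comp ?_
        exact (continuous_single (A := fun _ : Fin (n + 1) => ℂ) (Fin.last n)).comp
          Complex.continuous_conj
      have := (hcont.tendsto 0).mono_left (nhdsWithin_le_nhds (s := {(0 : ℂ)}ᶜ))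
      simpa using this
    have hlim' : Tendsto (fun s : ℂ => α.eval s⁻¹) (𝓝[≠] 0) (𝓝 (u * conj (eval 0 b))) :=
      hlim.congr' (by filter_upwards [self_mem_nhdsWithin] with s hs using (hval s hs).symm)
    have hα0 : α ≠ 0 := by
      intro h
      rw [h] at hlim'
      simp only [Polynomial.eval_zero] at hlim'
      have := tendsto_nhds_unique hlim' tendsto_const_nhds
      exact mul_ne_zero hu0 ((map_ne_zero _).2 h0) this
    have hdeg : 0 < α.degree := by
      rw [← Polynomial.natDegree_pos_iff_degree_pos, hα,
        Polynomial.natDegree_mul (left_ne_zero_of_mul hα0) (right_ne_zero_of_mul hα0),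
        Polynomial.natDegree_X_pow]
      omega
    have hinf := Polynomial.tendsto_norm_atTop α hdeg (l := 𝓝[≠] (0 : ℂ)) (z := fun s => s⁻¹)
      tendsto_norm_inv_nhdsNE_zero_atTop
    exact not_tendsto_nhds_of_tendsto_atTop hinf _ hlim'.norm
  refine ⟨N - j, u, hu1, fun x hx => ?_⟩
  have e := hrel x hx
  refine mul_left_cancel₀ (pow_ne_zero j hx) ?_
  rw [e]
  conv_lhs => rw [← Nat.add_sub_cancel' hjN, pow_add]
  ring

end Reflection

/-! ### Functions of the given form: polynomial numerator, bound and radial limits. -/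

/-- Two polynomials of the same modulus on the unit circle: their quotient has unimodular limits. -/
lemma exists_tendsto_div_of_norm_eval_eq (P Q : Polynomial ℂ) (hQ : Q ≠ 0)
    (h : ∀ t : ℂ, ‖t‖ = 1 → t ≠ 1 → ‖P.eval t‖ = ‖Q.eval t‖) :
    ∃ w : ℂ, ‖w‖ = 1 ∧ Tendsto (fun t => P.eval t / Q.eval t) (𝓝[≠] 1) (𝓝 w) := by
  induction hN : Q.natDegree generalizing P Q with
  | zero | succ N ih =>
    -- The moduli agree at `1` as well, by approach along the circle; so if `Q` vanishes at `1`,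
    -- both polynomials have the factor `t - 1`.
    have h1 : ‖P.eval 1‖ = ‖Q.eval 1‖ := by
      have hcont : Tendsto (fun s : ℝ => ‖P.eval (Complex.exp (s * Complex.I))‖ -
          ‖Q.eval (Complex.exp (s * Complex.I))‖) (𝓝[≠] 0) (𝓝 (‖P.eval 1‖ - ‖Q.eval 1‖)) := by
        have : Continuous fun s : ℝ => ‖P.eval (Complex.exp (s * Complex.I))‖ -
          ‖Q.eval (Complex.exp (s * Complex.I))‖ := by fun_prop
        simpa using (this.tendsto 0).mono_left (nhdsWithin_le_nhds (s := {(0 : ℝ)}ᶜ))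
      refine sub_eq_zero.1 (tendsto_nhds_unique hcont (tendsto_const_nhds.congr' ?_))
      have hπ : Set.Ioo (-Real.pi) Real.pi ∈ 𝓝[≠] (0 : ℝ) :=
        mem_nhdsWithin_of_mem_nhds (Ioo_mem_nhds (by linarith [Real.pi_pos]) Real.pi_pos)
      filter_upwards [hπ, self_mem_nhdsWithin] with s hs hs0
      refine (sub_eq_zero.2 (h _ (Complex.norm_exp_ofReal_mul_I s) fun he => hs0 ?_)).symm
      rw [← Complex.exp_zero] at he
      have := Complex.exp_inj_of_neg_pi_lt_of_le_pi (by simpa using hs.1)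
        (by simpa using hs.2.le) (by simpa using Real.pi_pos) (by simpa using Real.pi_pos.le) he
      simpa using this
    by_cases hQ1 : Q.eval 1 = 0
    · have hP1 : P.eval 1 = 0 := by rw [← norm_eq_zero, h1, hQ1, norm_zero]
      obtain ⟨Q', rfl⟩ := Polynomial.dvd_iff_isRoot.2 hQ1
      obtain ⟨P', rfl⟩ := Polynomial.dvd_iff_isRoot.2 hP1
      have hQ' : Q' ≠ 0 := right_ne_zero_of_mul hQ
      rw [Polynomial.natDegree_mul (Polynomial.X_sub_C_ne_zero 1) hQ',
        Polynomial.natDegree_X_sub_C] at hN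
      -- A constant nonzero `Q` has no root, so degree zero is contradictory here; in positive
      -- degree the factor `t - 1` is cancelled and the induction hypothesis applies.
      first
      | omega
      | obtain ⟨w, hw, hlim⟩ := ih P' Q' hQ' (fun t ht ht1 => by
          have := h t ht ht1
          rw [Polynomial.eval_mul, Polynomial.eval_mul, norm_mul, norm_mul] at this
          refine mul_left_cancel₀ (norm_ne_zero_iff.2 ?_) this
          simpa [sub_eq_zero] using ht1) (by omega)
        refine ⟨w, hw, hlim.congr' ?_⟩
        filter_upwards [self_mem_nhdsWithin] with t ht
        rw [Polynomial.eval_mul, Polynomial.eval_mul, mul_div_mul_left]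
        simpa [sub_eq_zero] using ht
    · refine ⟨P.eval 1 / Q.eval 1, ?_, ?_⟩
      · rw [norm_div, h1, div_self (norm_ne_zero_iff.2 hQ1)]
      · exact ((P.continuous.tendsto 1).div (Q.continuous.tendsto 1) hQ1).mono_left
          nhdsWithin_le_nhds

/-- Modulo `X i`, a polynomial is congruent to its restriction to `z i = 0`, and that restriction
vanishes on the polydisc. -/
lemma X_dvd_of_eval_update_eq_zero {d : ℕ} {H : MvPolynomial (Fin d) ℂ} {i : Fin d}
    (h : ∀ z ∈ polydisc d, z i = 0 → eval z H = 0) : X i ∣ H := by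
  classical
  set s : MvPolynomial (Fin d) ℂ →ₐ[ℂ] MvPolynomial (Fin d) ℂ :=
    aeval (Function.update X i 0) with hs
  have hdvd : ∀ G : MvPolynomial (Fin d) ℂ, X i ∣ G - s G := by
    intro G
    induction G using MvPolynomial.induction_on with
    | C a => simp [hs]
    | add p q hp hq => rw [map_add, add_sub_add_comm]; exact dvd_add hp hq
    | mul_X p j hp =>
      have : p * X j - s (p * X j) = (p - s p) * X j + s p * (X j - s (X j)) := by
        rw [map_mul]; ring
      rw [this]
      refine dvd_add (hp.mul_right _) (Dvd.dvd.mul_left ?_ _)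
      rw [hs, aeval_X]
      by_cases hj : j = i
      · subst hj; simp
      · simp [Function.update_of_ne hj]
  have heval : ∀ (G : MvPolynomial (Fin d) ℂ) (z : Fin d → ℂ),
      eval z (s G) = eval (Function.update z i 0) G := by
    intro G z
    induction G using MvPolynomial.induction_on with
    | C a => simp [hs]
    | add p q hp hq => simp only [map_add, hp, hq]
    | mul_X p j hp =>
      rw [map_mul, map_mul, map_mul, hp, hs, aeval_X, eval_X]
      by_cases hj : j = i
      · subst hj; simp
      · simp [Function.update_of_ne hj]
  have h0 : s H = 0 := by
    refine eq_zero_of_eval_eq_zero_on_polydisc fun z hz => ?_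
    rw [heval]
    refine h _ (fun j => ?_) (by simp)
    by_cases hj : j = i
    · subst hj; simp
    · simpa [Function.update_of_ne hj] using hz j
  simpa [h0] using hdvd H

variable {n : ℕ}

lemma pullback_X_last : pullback (n + 1) (X (Fin.last n)) = ∏ i, X i := by
  refine MvPolynomial.funext fun z => ?_
  rw [eval_pullback, eval_X, symmetrization_last]
  simp [map_prod]

/-- The pullback of `p` is the product of the pairwise coprime coordinates, each of which divides
the pullback of `H`; the quotient is symmetric and therefore descends. -/
lemma X_last_dvd {H : MvPolynomial (Fin (n + 1)) ℂ}
    (h : ∀ x ∈ symPolydisc (n + 1), x (Fin.last n) = 0 → eval x H = 0) : X (Fin.last n) ∣ H := by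
  have hi : ∀ i ∈ Finset.univ, X i ∣ pullback (n + 1) H := by
    refine fun i _ => X_dvd_of_eval_update_eq_zero fun z hz hzi => ?_
    rw [eval_pullback]
    refine h _ ⟨z, hz, rfl⟩ ?_
    rw [symmetrization_last]
    exact Finset.prod_eq_zero (Finset.mem_univ i) hzi
  have hrel : Set.Pairwise (Finset.univ : Finset (Fin (n + 1)))
      (Function.onFun IsRelPrime fun i => (X i : MvPolynomial (Fin (n + 1)) ℂ)) := by
    intro i _ j _ hij
    refine (X_prime (i := i)).irreducible.isRelPrime_iff_not_dvd.2 fun hd => hij ?_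
    simpa using hd
  obtain ⟨e, he⟩ := Finset.prod_dvd_of_isRelPrime hrel hi
  have hprod : (∏ i : Fin (n + 1), (X i : MvPolynomial (Fin (n + 1)) ℂ)) ≠ 0 :=
    Finset.prod_ne_zero_iff.2 fun i _ => X_ne_zero i
  have hes : e.IsSymmetric := by
    intro σ
    refine mul_left_cancel₀ hprod ?_
    rw [← he]
    have h1 : rename σ (pullback (n + 1) H) = pullback (n + 1) H := by
      refine MvPolynomial.funext fun z => ?_
      rw [eval_rename, eval_pullback, eval_pullback, symmetrization_comp_perm]
    have h2 : rename σ (∏ i : Fin (n + 1), (X i : MvPolynomial (Fin (n + 1)) ℂ)) = ∏ i, X i := by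
      rw [map_prod]
      simp only [rename_X]
      exact Equiv.prod_comp σ fun i => (X i : MvPolynomial (Fin (n + 1)) ℂ)
    conv_rhs => rw [← h1, he, map_mul, h2]
  obtain ⟨E, rfl⟩ := exists_pullback_eq hes
  exact ⟨E, pullback_injective _ (by rw [he, map_mul, pullback_X_last])⟩

/-- A point of disagreement would give an open set in the polydisc on which the nonzero polynomial
`∏ z i` vanishes. -/
lemma eqOn_symPolydisc_of_last_ne_zero {φ ψ : (Fin (n + 1) → ℂ) → ℂ}
    (hφ : ContinuousOn φ (symPolydisc (n + 1))) (hψ : ContinuousOn ψ (symPolydisc (n + 1)))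
    (h : ∀ x ∈ symPolydisc (n + 1), x (Fin.last n) ≠ 0 → φ x = ψ x) :
    Set.EqOn φ ψ (symPolydisc (n + 1)) := by
  rintro _ ⟨z₀, hz₀, rfl⟩
  by_contra hne
  have hc : ContinuousOn (fun z => φ (symmetrization (n + 1) z) - ψ (symmetrization (n + 1) z))
      (polydisc (n + 1)) :=
    (hφ.sub hψ).comp (continuous_symmetrization _).continuousOn fun z hz => ⟨z, hz, rfl⟩
  have hn := (isOpen_polydisc (n + 1)).mem_nhds hz₀
  have : pullback (n + 1) (X (Fin.last n)) = 0 := by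
    refine eq_zero_of_eventually_eval_eq_zero (z₀ := z₀) ?_
    filter_upwards [hn, (hc.continuousAt hn).eventually_ne (sub_ne_zero.2 hne)] with z hz hz'
    rw [eval_pullback, eval_X]
    by_contra h0
    exact hz' (sub_eq_zero.2 (h _ ⟨z, hz, rfl⟩ h0))
  rw [map_eq_zero_iff _ (pullback_injective _)] at this
  exact X_ne_zero _ this

lemma X_last_pow_dvd {g : (Fin (n + 1) → ℂ) → ℂ} (hg : ContinuousOn g (symPolydisc (n + 1)))
    (N : ℕ) (H : MvPolynomial (Fin (n + 1)) ℂ)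
    (h : ∀ x ∈ symPolydisc (n + 1), x (Fin.last n) ≠ 0 → x (Fin.last n) ^ N * g x = eval x H) :
    X (Fin.last n) ^ N ∣ H := by
  induction N generalizing H with
  | zero => simp
  | succ N ih =>
    have hdvd : X (Fin.last n) ∣ H := by
      refine X_last_dvd fun x hx hx0 => ?_
      have := eqOn_symPolydisc_of_last_ne_zero (φ := fun x => x (Fin.last n) ^ (N + 1) * g x)
        ((by fun_prop : Continuous fun x : Fin (n + 1) → ℂ =>
          x (Fin.last n) ^ (N + 1)).continuousOn.mul hg)
        (differentiable_eval H).continuous.continuousOn h hx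
      simp only [hx0] at this
      rw [← this]
      simp
    obtain ⟨H', rfl⟩ := hdvd
    rw [pow_succ']
    refine mul_dvd_mul_left _ (ih H' fun x hx hx0 => mul_left_cancel₀ hx0 ?_)
    rw [← mul_assoc, ← pow_succ', h x hx hx0, map_mul, eval_X]

/-- The reflected expression could a priori have a pole along `p = 0`; continuity of `f` there
excludes it, one factor `p` at a time through `X_last_pow_dvd`. -/
lemma exists_polynomial_numerator {f : (Fin (n + 1) → ℂ) → ℂ} {τ : ℂ} {k : ℕ}
    {ξ : MvPolynomial (Fin (n + 1)) ℂ} (hf : ContinuousOn f (symPolydisc (n + 1)))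
    (hξ : ∀ x ∈ symPolydisc (n + 1), eval x ξ ≠ 0)
    (h : HasInnerForm (symPolydisc (n + 1)) f τ k ξ) :
    ∃ H : MvPolynomial (Fin (n + 1)) ℂ,
      (∀ x ∈ symPolydisc (n + 1), f x * eval x ξ = eval x H) ∧
      ∀ x : Fin (n + 1) → ℂ, x (Fin.last n) ≠ 0 →
        eval x H = τ * x (Fin.last n) ^ k * conj (eval (reflection x) ξ) := by
  obtain ⟨N, ξ', hξ'⟩ := exists_reflected_polynomial ξ
  have hfξ : ContinuousOn (fun x => f x * eval x ξ) (symPolydisc (n + 1)) :=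
    hf.mul (differentiable_eval ξ).continuous.continuousOn
  obtain ⟨H, hH⟩ := X_last_pow_dvd hfξ N (C τ * X (Fin.last n) ^ k * ξ') (fun x hx hx0 => by
    rw [h x hx hx0, div_mul_cancel₀ _ (hξ x hx)]
    simp only [map_mul, map_pow, eval_C, eval_X, hξ' x hx0]
    ring)
  have hH' : ∀ x : Fin (n + 1) → ℂ, x (Fin.last n) ≠ 0 →
        eval x H = τ * x (Fin.last n) ^ k * conj (eval (reflection x) ξ) := by
    intro x hx
    have := congrArg (eval x) hH
    simp only [map_mul, map_pow, eval_C, eval_X, hξ' x hx] at this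
    refine mul_left_cancel₀ (pow_ne_zero N hx) ?_
    rw [← this]; ring
  refine ⟨H, ?_, hH'⟩
  refine eqOn_symPolydisc_of_last_ne_zero hfξ (differentiable_eval H).continuous.continuousOn ?_
  intro x hx hx0
  rw [hH' x hx0, h x hx hx0, div_mul_cancel₀ _ (hξ x hx)]

lemma symmetrization_smul' (d : ℕ) (t : ℂ) (z : Fin d → ℂ) (i : Fin d) :
    symmetrization d (t • z) i = t ^ ((i : ℕ) + 1) * symmetrization d z i := by
  simp only [symmetrization, Finset.mul_sum, Pi.smul_apply, smul_eq_mul]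
  refine Finset.sum_congr rfl fun s hs => ?_
  rw [Finset.prod_mul_distrib, Finset.prod_const, (Finset.mem_powersetCard.1 hs).2]

lemma dilation_mem_symPolydisc {d : ℕ} {r : ℝ} (hr0 : 0 ≤ r) (hr : r < 1) {x : Fin d → ℂ}
    (hx : x ∈ closure (symPolydisc d)) : dilation r x ∈ symPolydisc d := by
  obtain ⟨z, hz, rfl⟩ := closure_symPolydisc_subset d hx
  rw [← symmetrization_smul]
  refine ⟨_, fun i => ?_, rfl⟩
  rw [norm_mul, Complex.norm_real, Real.norm_of_nonneg hr0]
  exact (mul_le_of_le_one_right hr0 (hz i)).trans_lt hr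

lemma continuous_dilation {d : ℕ} : Continuous fun p : ℝ × (Fin d → ℂ) => dilation p.1 p.2 := by
  unfold dilation; fun_prop

lemma differentiable_dilation {d : ℕ} (r : ℝ) :
    Differentiable ℂ fun x : Fin d → ℂ => dilation r x := by
  unfold dilation; fun_prop

lemma dilation_one {d : ℕ} (x : Fin d → ℂ) : dilation 1 x = x := by
  ext i; simp [dilation]

/-- The symmetrized form of `1 / conj (z / r) = r (1 / conj z)`; the weights of a coordinate and of
its partner add up to `n + 1`, the weight of `p`. -/
lemma reflection_dilation_inv {r : ℝ} (hr : 0 < r) (x : Fin (n + 1) → ℂ) :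
    reflection (dilation r⁻¹ x) = dilation r (reflection x) := by
  have hr' : (r : ℂ) ≠ 0 := by exact_mod_cast hr.ne'
  ext i
  refine Fin.lastCases ?_ (fun j => ?_) i
  · simp [reflection_last, dilation, mul_comm]
  · rw [reflection_castSucc, dilation, dilation, dilation, reflection_castSucc]
    have hj : n + 1 = (j.rev.castSucc : ℕ) + 1 + ((j.castSucc : ℕ) + 1) := by
      simp; omega
    have h1 : (Fin.last n : ℕ) + 1 = (j.rev.castSucc : ℕ) + 1 + ((j.castSucc : ℕ) + 1) := hj
    rw [h1]
    simp only [map_mul, map_pow, Complex.conj_ofReal, Complex.ofReal_inv, map_inv₀]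
    generalize (j.rev.castSucc : ℕ) + 1 = α
    generalize (j.castSucc : ℕ) + 1 = β
    rw [pow_add, inv_pow, inv_pow]
    by_cases hp : conj (x (Fin.last n)) = 0
    · simp [hp]
    · field_simp

lemma norm_eval_eq_on_torus {τ : ℂ} {k : ℕ} {ξ H : MvPolynomial (Fin (n + 1)) ℂ} (hτ : ‖τ‖ = 1)
    (hH : ∀ x : Fin (n + 1) → ℂ, x (Fin.last n) ≠ 0 →
      eval x H = τ * x (Fin.last n) ^ k * conj (eval (reflection x) ξ))
    {ζ : Fin (n + 1) → ℂ} (hζ : ζ ∈ torus (n + 1)) :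
    ‖eval (symmetrization (n + 1) ζ) H‖ = ‖eval (symmetrization (n + 1) ζ) ξ‖ := by
  have hp := norm_symmetrization_last_of_mem_torus hζ
  have hp0 : symmetrization (n + 1) ζ (Fin.last n) ≠ 0 := by
    rw [← norm_ne_zero_iff, hp]; exact one_ne_zero
  rw [hH _ hp0, reflection_symmetrization_of_mem_torus hζ]
  simp [hτ, hp]

/-- Since `ξ` may vanish on the boundary, the maximum principle is not applied to `H / ξ`. Dilating
`ξ` by `r` and `H` by `1 / r` makes the denominator zero-free on the closure and keeps the quotient
exactly unimodular on the symmetrized torus, because reflection exchanges the two dilations; then `r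
→ 1`. -/
lemma norm_eval_le_of_reflection {τ : ℂ} {k : ℕ} {ξ H : MvPolynomial (Fin (n + 1)) ℂ}
    (hτ : ‖τ‖ = 1) (hξ : ∀ x ∈ symPolydisc (n + 1), eval x ξ ≠ 0)
    (hH : ∀ x : Fin (n + 1) → ℂ, x (Fin.last n) ≠ 0 →
      eval x H = τ * x (Fin.last n) ^ k * conj (eval (reflection x) ξ))
    {x : Fin (n + 1) → ℂ} (hx : x ∈ symPolydisc (n + 1)) : ‖eval x H‖ ≤ ‖eval x ξ‖ := by
  have key : ∀ r : ℝ, 0 < r → r < 1 →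
      ‖((r : ℂ) ^ (n + 1)) ^ k * eval (dilation r⁻¹ x) H‖ ≤ ‖eval (dilation r x) ξ‖ := by
    intro r hr0 hr
    have hr' : (r : ℂ) ≠ 0 := by exact_mod_cast hr0.ne'
    have hne : ∀ y ∈ closure (symPolydisc (n + 1)), eval (dilation r y) ξ ≠ 0 := fun y hy =>
      hξ _ (dilation_mem_symPolydisc hr0.le hr hy)
    have hdN : Differentiable ℂ fun y : Fin (n + 1) → ℂ =>
        ((r : ℂ) ^ (n + 1)) ^ k * eval (dilation r⁻¹ y) H :=
      ((differentiable_eval H).comp (differentiable_dilation r⁻¹)).const_mul _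
    have hdD : Differentiable ℂ fun y : Fin (n + 1) → ℂ => eval (dilation r y) ξ :=
      (differentiable_eval ξ).comp (differentiable_dilation r)
    have hA : MemUniformAlgebra (symPolydisc (n + 1)) fun y =>
        ((r : ℂ) ^ (n + 1)) ^ k * eval (dilation r⁻¹ y) H / eval (dilation r y) ξ :=
      ⟨hdN.continuous.continuousOn.div hdD.continuous.continuousOn hne,
        by
          simpa only [div_eq_mul_inv] using hdN.differentiableOn.fun_mul
            (hdD.differentiableOn.fun_inv fun y hy => hne y (subset_closure hy))⟩
    obtain ⟨_, ⟨ζ, hζ, rfl⟩, hle⟩ :=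
      (isClosedBoundary_torus (n + 1)).2.2 _ hA x (subset_closure hx)
    set y := symmetrization (n + 1) ζ with hy
    have hyc : y ∈ closure (symPolydisc (n + 1)) := closedPolydisc_mapsTo _ fun i => (hζ i).le
    have hp : ‖y (Fin.last n)‖ = 1 := norm_symmetrization_last_of_mem_torus hζ
    have hp0 : y (Fin.last n) ≠ 0 := by
      rw [← norm_ne_zero_iff, hp]; exact one_ne_zero
    have hval : ‖((r : ℂ) ^ (n + 1)) ^ k * eval (dilation r⁻¹ y) H‖ = ‖eval (dilation r y) ξ‖ := by
      have hp0' : dilation r⁻¹ y (Fin.last n) ≠ 0 := by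
        simp [dilation, hp0, hr0.ne']
      rw [hH _ hp0', reflection_dilation_inv hr0, hy, reflection_symmetrization_of_mem_torus hζ,
        ← hy]
      have : ((r : ℂ) ^ (n + 1)) ^ k * (dilation r⁻¹ y (Fin.last n)) ^ k = y (Fin.last n) ^ k := by
        rw [← mul_pow, dilation, ← mul_assoc, Fin.val_last, ← mul_pow, Complex.ofReal_inv,
          mul_inv_cancel₀ hr', one_pow, one_mul]
      rw [show ∀ a b c e : ℂ, a * (b * c * e) = b * (a * c) * e from fun _ _ _ _ => by ring, this]
      simp [hτ, hp]
    rw [norm_div, norm_div, hval, div_self (norm_ne_zero_iff.2 (hne y hyc)),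
      div_le_one (norm_pos_iff.2 (hne x (subset_closure hx)))] at hle
    exact hle
  have h1 : Tendsto (fun r : ℝ => ‖((r : ℂ) ^ (n + 1)) ^ k * eval (dilation r⁻¹ x) H‖) (𝓝[<] 1)
      (𝓝 ‖eval x H‖) := by
    have hc : ContinuousAt (fun r : ℝ => ‖((r : ℂ) ^ (n + 1)) ^ k * eval (dilation r⁻¹ x) H‖) 1 := by
      have h2 : ContinuousAt (fun r : ℝ => dilation r⁻¹ x) 1 :=
        continuous_dilation.continuousAt.comp (f := fun r : ℝ => (r⁻¹, x))
          ((continuousAt_inv₀ one_ne_zero).prodMk continuousAt_const)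
      refine ((by fun_prop : Continuous fun r : ℝ => ((r : ℂ) ^ (n + 1)) ^ k).continuousAt.mul
        ((differentiable_eval H).continuous.continuousAt.comp h2)).norm
    have := hc.tendsto.mono_left (nhdsWithin_le_nhds (s := Set.Iio (1 : ℝ)))
    simpa [dilation_one] using this
  have h2 : Tendsto (fun r : ℝ => ‖eval (dilation r x) ξ‖) (𝓝[<] 1) (𝓝 ‖eval x ξ‖) := by
    have hc : Continuous fun r : ℝ => ‖eval (dilation r x) ξ‖ :=
      ((differentiable_eval ξ).continuous.comp
        (continuous_dilation.comp (by fun_prop : Continuous fun r : ℝ => (r, x)))).norm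
    have := (hc.tendsto 1).mono_left (nhdsWithin_le_nhds (s := Set.Iio (1 : ℝ)))
    simpa [dilation_one] using this
  refine le_of_tendsto_of_tendsto h1 h2 ?_
  filter_upwards [Ioo_mem_nhdsLT (zero_lt_one (α := ℝ))] with r hr using key r hr.1 hr.2

lemma zero_mem_symPolydisc (d : ℕ) : (0 : Fin d → ℂ) ∈ symPolydisc d := by
  refine ⟨0, zero_mem_polydisc d, ?_⟩
  have := symmetrization_smul' d 0 0
  ext i
  simpa using this i

/-- Functions of the form `τ p^k conj (ξ (reflection)) / ξ` are rational inner. -/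
theorem isRationalInner_of_hasInnerForm {f : (Fin (n + 1) → ℂ) → ℂ} {τ : ℂ} {k : ℕ}
    {ξ : MvPolynomial (Fin (n + 1)) ℂ} (hτ : ‖τ‖ = 1)
    (hξ : ∀ x ∈ symPolydisc (n + 1), eval x ξ ≠ 0)
    (hf : DifferentiableOn ℂ f (symPolydisc (n + 1)))
    (h : HasInnerForm (symPolydisc (n + 1)) f τ k ξ) : IsRationalInner f := by
  obtain ⟨H, hfH, hH⟩ := exists_polynomial_numerator hf.continuousOn hξ h
  have hfdiv : ∀ x ∈ symPolydisc (n + 1), f x = eval x H / eval x ξ := fun x hx => by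
    rw [eq_div_iff (hξ x hx), hfH x hx]
  have hξ0 : eval 0 ξ ≠ 0 := hξ 0 (zero_mem_symPolydisc _)
  refine ⟨⟨H, ξ, by rintro rfl; simp at hξ0, fun x hx _ => hfdiv x hx⟩, hf, ⟨1, fun x hx => ?_⟩,
    Eventually.of_forall ?_⟩
  · rw [hfdiv x hx, norm_div]
    exact div_le_one_of_le₀ (norm_eval_le_of_reflection hτ hξ hH hx) (norm_nonneg _)
  · intro x hx
    rw [distinguishedBoundary_symPolydisc] at hx
    obtain ⟨ζ, hζ, rfl⟩ := hx
    set x := symmetrization (n + 1) ζ with hxdef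
    -- On the ray through `x`, numerator and denominator are polynomials in `t` that make sense for
    -- complex `t`; when `|t| = 1`, `t • ζ` stays on the torus and their moduli agree.
    let g : Fin (n + 1) → Polynomial ℂ := fun i => Polynomial.X ^ ((i : ℕ) + 1) * Polynomial.C (x i)
    have hg : ∀ (G : MvPolynomial (Fin (n + 1)) ℂ) (t : ℂ),
        (aeval g G).eval t = eval (symmetrization (n + 1) (t • ζ)) G := by
      intro G t
      rw [eval_aeval_polynomial]
      congr 2
      ext i
      rw [symmetrization_smul']
      simp only [g, ← hxdef, Polynomial.eval_mul, Polynomial.eval_pow, Polynomial.eval_X,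
        Polynomial.eval_C]
    have hQ : aeval g ξ ≠ 0 := by
      intro h0
      have h1 := hg ξ 0
      have h2 : symmetrization (n + 1) ((0 : ℂ) • ζ) = 0 := by
        ext i; rw [symmetrization_smul']; simp
      rw [h0, h2, Polynomial.eval_zero] at h1
      exact hξ0 h1.symm
    obtain ⟨w, hw, hlim⟩ := exists_tendsto_div_of_norm_eval_eq (aeval g H) (aeval g ξ) hQ
      (fun t ht _ => by
        rw [hg, hg]
        exact norm_eval_eq_on_torus hτ hH fun i => by simp [ht, hζ i])
    refine ⟨w, hw, ?_⟩
    have hcast : Tendsto (fun r : ℝ => (r : ℂ)) (𝓝[<] 1) (𝓝[≠] 1) := by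
      refine tendsto_nhdsWithin_iff.2 ⟨?_, ?_⟩
      · have := (Complex.continuous_ofReal.tendsto 1).mono_left
          (nhdsWithin_le_nhds (s := Set.Iio (1 : ℝ)))
        simpa using this
      · filter_upwards [self_mem_nhdsWithin] with r hr
        have : r ≠ 1 := ne_of_lt hr
        simpa using this
    refine (hlim.comp hcast).congr' ?_
    filter_upwards [Ioo_mem_nhdsLT (zero_lt_one (α := ℝ))] with r hr
    have hr' := dilation_mem_symPolydisc hr.1.le hr.2
      (closedPolydisc_mapsTo (n + 1) fun i => (hζ i).le)
    rw [Function.comp_apply, hg, hg, hxdef, hfdiv _ hr', ← symmetrization_smul]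
    rfl

/-! ### Inner functions in the disc algebra are rational. -/

section FiniteBlaschke

open Metric

/-- Inner functions in the disc algebra. -/
def IsDiscInner (g : ℂ → ℂ) : Prop :=
  DiffContOnCl ℂ g (ball 0 1) ∧ ∀ z ∈ sphere (0 : ℂ) 1, ‖g z‖ = 1

lemma IsDiscInner.norm_le_one {g : ℂ → ℂ} (hg : IsDiscInner g) {z : ℂ} (hz : z ∈ ball (0 : ℂ) 1) :
    ‖g z‖ ≤ 1 := by
  refine Complex.norm_le_of_forall_mem_frontier_norm_le isBounded_ball hg.1 (fun w hw => ?_)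
    (subset_closure hz)
  rw [frontier_ball _ one_ne_zero] at hw
  exact (hg.2 w hw).le

/-- Both `g` and `1 / g` are bounded by `1`, so `|g| = 1` throughout and the maximum principle
applies. -/
lemma IsDiscInner.eq_const {g : ℂ → ℂ} (hg : IsDiscInner g) (h0 : ∀ z ∈ ball (0 : ℂ) 1, g z ≠ 0) :
    ∀ z ∈ ball (0 : ℂ) 1, g z = g 0 := by
  have hne : ∀ z ∈ closure (ball (0 : ℂ) 1), g z ≠ 0 := by
    intro z hz
    rw [closure_ball _ one_ne_zero, ← ball_union_sphere] at hz
    rcases hz with hz | hz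
    · exact h0 z hz
    · rw [← norm_ne_zero_iff, hg.2 z hz]; exact one_ne_zero
  have hinv : IsDiscInner fun z => (g z)⁻¹ := by
    refine ⟨hg.1.inv hne, fun z hz => ?_⟩
    rw [norm_inv, hg.2 z hz, inv_one]
  have hnorm : ∀ z ∈ ball (0 : ℂ) 1, ‖g z‖ = 1 := by
    intro z hz
    refine le_antisymm (hg.norm_le_one hz) ?_
    have h1 := hinv.norm_le_one hz
    rw [norm_inv] at h1
    exact (inv_le_one₀ (norm_pos_iff.2 (h0 z hz))).1 h1
  have hmem : (0 : ℂ) ∈ ball (0 : ℂ) 1 := mem_ball_self one_pos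
  refine Complex.eqOn_of_isPreconnected_of_isMaxOn_norm (convex_ball 0 1).isPreconnected
    isOpen_ball hg.1.differentiableOn hmem fun z hz => ?_
  show ‖g z‖ ≤ ‖g 0‖
  rw [hnorm z hz, hnorm 0 hmem]

lemma normSq_one_sub_conj_mul (a z : ℂ) :
    ‖1 - conj a * z‖ ^ 2 - ‖z - a‖ ^ 2 = (1 - ‖a‖ ^ 2) * (1 - ‖z‖ ^ 2) := by
  simp only [← Complex.normSq_eq_norm_sq, Complex.normSq_apply, Complex.sub_re, Complex.sub_im,
    Complex.mul_re, Complex.mul_im, Complex.conj_re, Complex.conj_im, Complex.one_re,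
    Complex.one_im]
  ring

lemma one_sub_conj_mul_ne_zero {a z : ℂ} (ha : ‖a‖ < 1) (hz : ‖z‖ ≤ 1) : 1 - conj a * z ≠ 0 := by
  intro h
  have h1 : conj a * z = 1 := (sub_eq_zero.1 h).symm
  have h2 : ‖conj a * z‖ < 1 := by
    rw [norm_mul, RCLike.norm_conj]
    exact (mul_le_of_le_one_right (norm_nonneg a) hz).trans_lt ha
  rw [h1, norm_one] at h2
  exact lt_irrefl _ h2

/-- Division by a Blaschke factor. -/
lemma IsDiscInner.dslope {g : ℂ → ℂ} (hg : IsDiscInner g) {a : ℂ} (ha : ‖a‖ < 1) (hga : g a = 0) :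
    IsDiscInner fun z => (1 - conj a * z) * dslope g a z := by
  have hmem : ball (0 : ℂ) 1 ∈ 𝓝 a := isOpen_ball.mem_nhds (by simpa using ha)
  refine ⟨⟨?_, ?_⟩, fun z hz => ?_⟩
  · exact (by fun_prop : Differentiable ℂ fun z => 1 - conj a * z).differentiableOn.mul
      ((Complex.differentiableOn_dslope hmem).2 hg.1.differentiableOn)
  · refine (by fun_prop : Continuous fun z => 1 - conj a * z).continuousOn.mul ?_
    exact (continuousOn_dslope (mem_of_superset hmem subset_closure)).2
      ⟨hg.1.continuousOn, hg.1.differentiableAt isOpen_ball (mem_of_mem_nhds hmem)⟩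
  · have hz1 : ‖z‖ = 1 := by simpa using hz
    have hza : z ≠ a := by rintro rfl; linarith
    have h1 := normSq_one_sub_conj_mul a z
    rw [hz1, one_pow, sub_self, mul_zero, sub_eq_zero] at h1
    have h2 : ‖1 - conj a * z‖ = ‖z - a‖ :=
      (pow_left_inj₀ (norm_nonneg _) (norm_nonneg _) two_ne_zero).1 h1
    rw [norm_mul, dslope_of_ne _ hza, slope_def_field, hga, sub_zero, norm_div, hg.2 z hz, h2]
    exact mul_one_div_cancel (norm_ne_zero_iff.2 (sub_ne_zero.2 hza))

lemma sub_mul_dslope {g : ℂ → ℂ} {a : ℂ} (hga : g a = 0) (z : ℂ) :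
    (z - a) * dslope g a z = g z := by
  have := sub_smul_dslope g a z
  rwa [hga, sub_zero, smul_eq_mul] at this

/-- Dividing out a Blaschke factor multiplies `|g z₀|` by at least `1 / κ`, while the quotient is
still bounded by `1`. This bounds the number of divisions by `N` without counting zeros. -/
lemma IsDiscInner.exists_polynomial_aux {ρ κ : ℝ} {z₀ : ℂ} (hz₀ : ‖z₀‖ < 1)
    (hκ : 0 ≤ κ) (hκρ : ∀ a : ℂ, ‖a‖ ≤ ρ → ‖z₀ - a‖ ≤ κ * ‖1 - conj a * z₀‖) (N : ℕ) :
    ∀ g : ℂ → ℂ, IsDiscInner g → (∀ a ∈ ball (0 : ℂ) 1, g a = 0 → ‖a‖ ≤ ρ) → κ ^ N < ‖g z₀‖ →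
      ∃ P Q : Polynomial ℂ, Q ≠ 0 ∧ ∀ z ∈ ball (0 : ℂ) 1, g z * Q.eval z = P.eval z := by
  have hz₀' : z₀ ∈ ball (0 : ℂ) 1 := by simpa using hz₀
  induction N with
  | zero =>
    intro g hg _ h
    have := hg.norm_le_one hz₀'
    rw [pow_zero] at h
    linarith
  | succ N ih =>
    intro g hg hzero h
    by_cases hne : ∀ z ∈ ball (0 : ℂ) 1, g z ≠ 0
    · exact ⟨Polynomial.C (g 0), 1, one_ne_zero, fun z hz => by simp [hg.eq_const hne z hz]⟩
    · push Not at hne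
      obtain ⟨a, ha, hga⟩ := hne
      have haρ := hzero a ha hga
      have ha1 : ‖a‖ < 1 := by simpa using ha
      obtain ⟨P, Q, hQ, hPQ⟩ := ih _ (hg.dslope ha1 hga) (fun b hb hb0 => by
          have h1 := (mul_eq_zero.1 hb0).resolve_left
            (one_sub_conj_mul_ne_zero ha1 (by simpa using (mem_ball_zero_iff.1 hb).le))
          exact hzero b hb (by rw [← sub_mul_dslope hga b, h1, mul_zero])) (by
          refine lt_of_mul_lt_mul_left ?_ hκ
          rw [← pow_succ', norm_mul, ← mul_assoc]
          refine h.trans_le ?_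
          rw [← sub_mul_dslope hga z₀, norm_mul]
          exact mul_le_mul_of_nonneg_right (hκρ a haρ) (norm_nonneg _))
      refine ⟨(Polynomial.X - Polynomial.C a) * P,
        (1 - Polynomial.C (conj a) * Polynomial.X) * Q, mul_ne_zero (fun h0 => ?_) hQ,
        fun z hz => ?_⟩
      · have := congrArg (Polynomial.eval 0) h0
        simp at this
      · have h1 := hPQ z hz
        simp only [Polynomial.eval_mul, Polynomial.eval_sub, Polynomial.eval_X, Polynomial.eval_C,
          Polynomial.eval_one]
        rw [← h1, ← sub_mul_dslope hga z]
        ring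

/-- Inner functions in the disc algebra are rational. -/
lemma IsDiscInner.exists_polynomial {g : ℂ → ℂ} (hg : IsDiscInner g) :
    ∃ P Q : Polynomial ℂ, Q ≠ 0 ∧ ∀ z ∈ ball (0 : ℂ) 1, g z * Q.eval z = P.eval z := by
  -- The zeros form a compact set that avoids the circle, where `|g| = 1`.
  obtain ⟨ρ, hρ0, hρ1, hρ⟩ : ∃ ρ : ℝ, 0 ≤ ρ ∧ ρ < 1 ∧
      ∀ a ∈ closedBall (0 : ℂ) 1, g a = 0 → ‖a‖ ≤ ρ := by
    have hc : ContinuousOn g (closedBall 0 1) := by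
      rw [← closure_ball _ one_ne_zero]; exact hg.1.continuousOn
    have hK : IsCompact (closedBall (0 : ℂ) 1 ∩ g ⁻¹' {0}) :=
      (isCompact_closedBall 0 1).of_isClosed_subset
        (hc.preimage_isClosed_of_isClosed isClosed_closedBall isClosed_singleton)
        Set.inter_subset_left
    rcases (closedBall (0 : ℂ) 1 ∩ g ⁻¹' {0}).eq_empty_or_nonempty with h | h
    · refine ⟨0, le_rfl, one_pos, fun a ha h0 => ?_⟩
      have : a ∈ closedBall (0 : ℂ) 1 ∩ g ⁻¹' {0} := ⟨ha, h0⟩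
      rw [h] at this
      exact absurd this (Set.notMem_empty a)
    · obtain ⟨u, hu, hmax⟩ := hK.exists_isMaxOn h (f := fun z => ‖z‖) continuous_norm.continuousOn
      refine ⟨‖u‖, norm_nonneg _, lt_of_le_of_ne (by simpa using hu.1) fun h1 => ?_,
        fun a ha h0 => hmax ⟨ha, h0⟩⟩
      have := hg.2 u (by simpa using h1)
      rw [show g u = 0 from hu.2, norm_zero] at this
      exact zero_ne_one this
  -- The base point lies beyond all zeros, so `g r ≠ 0`.
  obtain ⟨r, hρr, hr1⟩ := exists_between hρ1
  have hr0 : 0 < r := hρ0.trans_lt hρr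
  have hrn : ‖(r : ℂ)‖ = r := by rw [Complex.norm_real, Real.norm_of_nonneg hr0.le]
  have hgr : g r ≠ 0 := by
    intro h
    have := hρ r (by simpa [abs_of_pos hr0] using hr1.le) h
    rw [hrn] at this
    linarith
  have hne : ∀ a : ℂ, ‖a‖ ≤ ρ → 1 - conj a * (r : ℂ) ≠ 0 := fun a ha =>
    one_sub_conj_mul_ne_zero (ha.trans_lt hρ1) (by rw [hrn]; exact hr1.le)
  -- `κ` is the largest pseudohyperbolic distance from `r` to a point of the closed disc of radius
  -- `ρ`.
  obtain ⟨u, hu, hmax⟩ := (isCompact_closedBall (0 : ℂ) ρ).exists_isMaxOn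
    ⟨0, mem_closedBall_self hρ0⟩ (f := fun a => ‖(r : ℂ) - a‖ / ‖1 - conj a * r‖) (by
      refine ContinuousOn.div (by fun_prop) ?_ fun a ha =>
        norm_ne_zero_iff.2 (hne a (by simpa using ha))
      exact (continuous_const.sub (Complex.continuous_conj.mul continuous_const)).norm.continuousOn)
  set κ := ‖(r : ℂ) - u‖ / ‖1 - conj u * r‖
  have hu' : ‖u‖ ≤ ρ := by simpa using hu
  have hκ0 : 0 ≤ κ := by positivity
  have hκ1 : κ < 1 := by
    rw [div_lt_one (norm_pos_iff.2 (hne u hu'))]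
    refine lt_of_pow_lt_pow_left₀ 2 (norm_nonneg _) ?_
    have h1 := normSq_one_sub_conj_mul u r
    have h2 : 0 < (1 - ‖u‖ ^ 2) * (1 - ‖(r : ℂ)‖ ^ 2) := by
      rw [hrn]
      have h3 : ‖u‖ < 1 := hu'.trans_lt hρ1
      refine mul_pos ?_ ?_
      · nlinarith [norm_nonneg u]
      · nlinarith
    linarith
  obtain ⟨N, hN⟩ := exists_pow_lt_of_lt_one (norm_pos_iff.2 hgr) hκ1
  refine IsDiscInner.exists_polynomial_aux (z₀ := r) (by rw [hrn]; exact hr1) hκ0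
    (fun a ha => ?_) N g hg (fun a ha => hρ a (ball_subset_closedBall ha)) hN
  rw [← div_le_iff₀ (norm_pos_iff.2 (hne a ha))]
  exact hmax (show a ∈ closedBall 0 ρ by simpa using ha)

end FiniteBlaschke

/-! ### Taylor coefficients of functions on the disc. -/

section TaylorCoefficients

open Metric

/-- The Taylor coefficients at `0` of a holomorphic function on the unit disc. -/
noncomputable def taylorCoeff (h : ℂ → ℂ) (n : ℕ) : ℂ :=
  (2 * Real.pi * Complex.I)⁻¹ * ∮ z in C(0, 1 / 2), (1 / z ^ (n + 1)) * h z

lemma diffContOnCl_half {h : ℂ → ℂ} (hh : DifferentiableOn ℂ h (ball 0 1)) :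
    DiffContOnCl ℂ h (ball 0 (1 / 2)) := by
  refine (hh.mono ?_).diffContOnCl
  rw [closure_ball _ (by norm_num)]
  exact closedBall_subset_ball (by norm_num)

lemma taylorCoeff_eq {h : ℂ → ℂ} (hh : DifferentiableOn ℂ h (ball 0 1)) (n : ℕ) :
    taylorCoeff h n = (n.factorial : ℂ)⁻¹ * iteratedDeriv n h 0 := by
  have := (diffContOnCl_half hh).circleIntegral_one_div_sub_center_pow_smul (by norm_num) n
  simp only [sub_zero, smul_eq_mul] at this
  rw [taylorCoeff, this]
  have hpi : (2 * Real.pi * Complex.I : ℂ) ≠ 0 := Complex.two_pi_I_ne_zero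
  field_simp

lemma hasSum_taylorCoeff {h : ℂ → ℂ} (hh : DifferentiableOn ℂ h (ball 0 1)) {z : ℂ}
    (hz : z ∈ ball (0 : ℂ) 1) : HasSum (fun n => taylorCoeff h n * z ^ n) (h z) := by
  have := Complex.hasSum_taylorSeries_on_ball hh hz
  convert! this using 2 with n
  rw [taylorCoeff_eq hh]
  simp only [sub_zero, smul_eq_mul]
  ring

/-- In the integral form, multiplication by `z ^ i` only shifts the exponent; once the pole is gone,
Cauchy's theorem gives zero. -/
lemma taylorCoeff_pow_mul {h : ℂ → ℂ} (hh : DifferentiableOn ℂ h (ball 0 1)) (i n : ℕ) :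
    taylorCoeff (fun z => z ^ i * h z) n = if i ≤ n then taylorCoeff h (n - i) else 0 := by
  have hne : ∀ z ∈ sphere (0 : ℂ) (1 / 2), z ≠ 0 := by
    rintro z hz rfl
    simp at hz
  split_ifs with hi
  · rw [taylorCoeff, taylorCoeff]
    congr 1
    refine circleIntegral.integral_congr (by norm_num) fun z hz => ?_
    have hz0 := hne z hz
    have : n + 1 = i + (n - i + 1) := by omega
    rw [this, pow_add]
    field_simp
  · rw [taylorCoeff]
    have : (∮ z in C(0, 1 / 2), 1 / z ^ (n + 1) * (z ^ i * h z)) =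
        ∮ z in C(0, 1 / 2), z ^ (i - (n + 1)) * h z := by
      refine circleIntegral.integral_congr (by norm_num) fun z hz => ?_
      have hz0 := hne z hz
      have : i = (n + 1) + (i - (n + 1)) := by omega
      rw [show z ^ i = z ^ (n + 1) * z ^ (i - (n + 1)) by rw [← pow_add, ← this]]
      field_simp
    rw [this, DiffContOnCl.circleIntegral_eq_zero (by norm_num), mul_zero]
    exact diffContOnCl_half ((differentiable_id.pow _).differentiableOn.mul hh)

lemma taylorCoeff_sum {ι : Type*} (s : Finset ι) (c : ι → ℂ) {h : ι → ℂ → ℂ}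
    (hh : ∀ i ∈ s, DifferentiableOn ℂ (h i) (ball 0 1)) (n : ℕ) :
    taylorCoeff (fun z => ∑ i ∈ s, c i * h i z) n = ∑ i ∈ s, c i * taylorCoeff (h i) n := by
  have h1 : ∀ z : ℂ, 1 / z ^ (n + 1) * ∑ i ∈ s, c i * h i z =
      ∑ i ∈ s, c i * (1 / z ^ (n + 1) * h i z) := fun z => by
    rw [Finset.mul_sum]
    exact Finset.sum_congr rfl fun i _ => by ring
  simp only [taylorCoeff, h1]
  rw [circleIntegral.integral_fun_sum, Finset.mul_sum]
  · simp only [circleIntegral.integral_const_mul]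
    exact Finset.sum_congr rfl fun i _ => by ring
  · intro i hi
    refine ContinuousOn.circleIntegrable (by norm_num) (continuousOn_const.mul ?_)
    refine ContinuousOn.mul (ContinuousOn.div continuousOn_const (by fun_prop) fun z hz => ?_)
      ((hh i hi).continuousOn.mono (sphere_subset_closedBall.trans
        (closedBall_subset_ball (by norm_num))))
    refine pow_ne_zero _ ?_
    rintro rfl
    simp at hz

lemma taylorCoeff_polynomial_mul {h : ℂ → ℂ} (hh : DifferentiableOn ℂ h (ball 0 1)) {m : ℕ}
    (q : Fin m → ℂ) (n : ℕ) :
    taylorCoeff (fun z => h z * ∑ i, q i * z ^ (i : ℕ)) n =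
      ∑ i, q i * if (i : ℕ) ≤ n then taylorCoeff h (n - i) else 0 := by
  have h1 : (fun z => h z * ∑ i, q i * z ^ (i : ℕ)) = fun z => ∑ i, q i * (z ^ (i : ℕ) * h z) := by
    ext z
    rw [Finset.mul_sum]
    exact Finset.sum_congr rfl fun i _ => by ring
  rw [h1, taylorCoeff_sum (h := fun (i : Fin m) z => z ^ (i : ℕ) * h z) _ _ fun i _ =>
    (by fun_prop : Differentiable ℂ fun z : ℂ => z ^ (i : ℕ)).differentiableOn.fun_mul hh]
  simp only [taylorCoeff_pow_mul hh]

lemma taylorCoeff_polynomial {P : Polynomial ℂ} {n : ℕ} (hn : P.natDegree < n) :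
    taylorCoeff (fun z => P.eval z) n = 0 := by
  have h1 : (fun z => P.eval z) = fun z =>
      (fun _ => 1 : ℂ → ℂ) z * ∑ i : Fin (P.natDegree + 1), P.coeff i * z ^ (i : ℕ) := by
    ext z
    rw [Polynomial.eval_eq_sum_range, Finset.sum_range, one_mul]
  rw [h1, taylorCoeff_polynomial_mul (differentiableOn_const 1)]
  refine Finset.sum_eq_zero fun i _ => ?_
  have hi : n - i ≠ 0 := by omega
  rw [taylorCoeff_eq (differentiableOn_const 1), iteratedDeriv_const, if_neg hi]
  simp

lemma taylorCoeff_congr {g h : ℂ → ℂ} (hgh : Set.EqOn g h (ball 0 1)) (n : ℕ) :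
    taylorCoeff g n = taylorCoeff h n := by
  rw [taylorCoeff, taylorCoeff]
  congr 1
  refine circleIntegral.integral_congr (by norm_num) fun z hz => ?_
  rw [hgh (mem_ball_zero_iff.2 _)]
  rw [mem_sphere_zero_iff_norm.1 hz]; norm_num

end TaylorCoefficients

lemma map_eq_sum_single {K : Type*} [CommSemiring K] {k : ℕ} (f : (Fin k → K) →ₗ[K] K)
    (w : Fin k → K) : f w = ∑ i, w i * f (Pi.single i 1) := by
  conv_lhs => rw [pi_eq_sum_univ' w]
  rw [map_sum]
  exact Finset.sum_congr rfl fun i _ => by rw [map_smul, smul_eq_mul]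

/-! ### Homogeneous components of holomorphic functions on the polydisc. -/

section PartialDerivatives

open Metric

/-- Directional derivatives of holomorphic functions of several variables are holomorphic. -/
lemma differentiableOn_fderiv_apply {d : ℕ} {F : (Fin d → ℂ) → ℂ} {U : Set (Fin d → ℂ)}
    (hU : IsOpen U) (hF : DifferentiableOn ℂ F U) (v : Fin d → ℂ) :
    DifferentiableOn ℂ (fun z => fderiv ℂ F z v) U := by
  intro z₀ hz₀
  refine DifferentiableAt.differentiableWithinAt ?_
  obtain ⟨δ, M, hδ, hball, hM⟩ : ∃ δ M : ℝ, 0 < δ ∧ ball z₀ (3 * δ) ⊆ U ∧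
      ∀ z ∈ ball z₀ (3 * δ), ‖F z‖ ≤ M := by
    have h1 : ∀ᶠ z in 𝓝 z₀, z ∈ U ∧ ‖F z‖ < ‖F z₀‖ + 1 :=
      (hU.eventually_mem hz₀).and ((hF.continuousOn.continuousAt (hU.mem_nhds hz₀)).norm.eventually
        (gt_mem_nhds (lt_add_one _)))
    obtain ⟨ε, hε, h2⟩ := Metric.eventually_nhds_iff_ball.1 h1
    refine ⟨ε / 3, ‖F z₀‖ + 1, by positivity, fun z hz => (h2 z ?_).1, fun z hz => (h2 z ?_).2.le⟩
    all_goals rwa [mul_div_cancel₀ _ (three_ne_zero)] at hz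
  -- A circle of radius `r` in the direction `v` moves points by less than `δ`; the summand `1`
  -- allows `v = 0`.
  set r : ℝ := δ / (‖v‖ + 1) with hr
  have hv1 : 0 < ‖v‖ + 1 := by positivity
  have hr0 : 0 < r := by positivity
  have hrv : ∀ t : ℂ, ‖t‖ ≤ r → ‖t • v‖ < δ := by
    intro t ht
    rw [norm_smul]
    calc ‖t‖ * ‖v‖ ≤ r * ‖v‖ := by gcongr
      _ < r * (‖v‖ + 1) := by gcongr; linarith
      _ = δ := by rw [hr]; field_simp
  have hmem : ∀ z ∈ ball z₀ δ, ∀ t : ℂ, ‖t‖ ≤ r → z + t • v ∈ ball z₀ (2 * δ) := by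
    intro z hz t ht
    rw [mem_ball, dist_eq_norm] at hz ⊢
    calc ‖z + t • v - z₀‖ = ‖(z - z₀) + t • v‖ := by congr 1; abel
      _ ≤ ‖z - z₀‖ + ‖t • v‖ := norm_add_le _ _
      _ < 2 * δ := by linarith [hrv t ht]
  have h23 : ball z₀ (2 * δ) ⊆ ball z₀ (3 * δ) := ball_subset_ball (by linarith)
  have hFd : ∀ w ∈ ball z₀ (2 * δ), DifferentiableAt ℂ F w := fun w hw =>
    hF.differentiableAt (hU.mem_nhds (hball (h23 hw)))
  have hbound : ∀ w ∈ ball z₀ (2 * δ), ‖fderiv ℂ F w‖ ≤ 2 * M / δ := by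
    intro w hw
    have hsub : ball w δ ⊆ ball z₀ (3 * δ) := by
      refine ball_subset_ball' ?_
      rw [mem_ball] at hw
      linarith
    refine Complex.norm_fderiv_le_div_of_mapsTo_ball (hF.mono (hsub.trans hball)) ?_ hδ
    intro u hu
    rw [mem_closedBall, dist_eq_norm]
    calc ‖F u - F w‖ ≤ ‖F u‖ + ‖F w‖ := norm_sub_le _ _
      _ ≤ 2 * M := by linarith [hM u (hsub hu), hM w (h23 hw)]
  have hline : ∀ z ∈ ball z₀ δ, ∀ t : ℂ, ‖t‖ ≤ r →
      HasDerivAt (fun s : ℂ => F (z + s • v)) (fderiv ℂ F (z + t • v) v) t := by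
    intro z hz t ht
    have h1 : HasDerivAt (fun s : ℂ => z + s • v) v t := by
      simpa using ((hasDerivAt_id t).smul_const v).const_add z
    exact (hFd _ (hmem z hz t ht)).hasFDerivAt.comp_hasDerivAt t h1
  set K : ℝ → ℂ := fun θ => deriv (circleMap 0 r) θ * (1 / circleMap 0 r θ ^ 2) with hK
  have hKc : Continuous K := by
    have h1 : ∀ θ, circleMap 0 r θ ≠ 0 := fun θ => circleMap_ne_center hr0.ne'
    simp only [hK, deriv_circleMap]
    refine Continuous.mul (by fun_prop) (Continuous.div continuous_const (by fun_prop) fun θ =>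
      pow_ne_zero _ (h1 θ))
  have hnc : ∀ θ, ‖circleMap 0 r θ‖ ≤ r := fun θ => by simp [abs_of_pos hr0]
  -- Cauchy's formula writes the directional derivative as an integral of values of `F`, which can
  -- be differentiated in `z` under the integral sign thanks to the uniform bound on `fderiv ℂ F`.
  have hcauchy : ∀ z ∈ ball z₀ δ, fderiv ℂ F z v = (2 * Real.pi * Complex.I)⁻¹ *
      ∫ θ in (0 : ℝ)..2 * Real.pi, K θ * F (z + circleMap 0 r θ • v) := by
    intro z hz
    have hdc : DiffContOnCl ℂ (fun s : ℂ => F (z + s • v)) (ball 0 r) := by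
      refine DifferentiableOn.diffContOnCl ?_
      rw [closure_ball _ hr0.ne']
      exact fun t ht => (hline z hz t (by simpa using ht)).differentiableAt.differentiableWithinAt
    have h1 := hdc.deriv_eq_smul_circleIntegral hr0
    have h2 := (hline z hz 0 (by simpa using hr0.le)).deriv
    rw [zero_smul, add_zero] at h2
    rw [h2] at h1
    simp only [sub_zero, smul_eq_mul, circleIntegral] at h1
    have hpi : (2 * Real.pi * Complex.I : ℂ) ≠ 0 := Complex.two_pi_I_ne_zero
    rw [← mul_right_inj' hpi, ← h1, mul_inv_cancel_left₀ hpi]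
    refine intervalIntegral.integral_congr fun θ _ => ?_
    simp only [hK]
    ring
  have hcontF : ∀ z ∈ ball z₀ δ, Continuous fun θ : ℝ => F (z + circleMap 0 r θ • v) := by
    intro z hz
    rw [continuous_iff_continuousAt]
    intro θ
    have h1 : ContinuousAt (fun θ : ℝ => z + circleMap 0 r θ • v) θ :=
      Continuous.continuousAt (by fun_prop)
    exact ContinuousAt.comp (g := F) (hFd _ (hmem z hz _ (hnc θ))).continuousAt h1
  have hD : HasFDerivAt (fun z => ∫ θ in (0 : ℝ)..2 * Real.pi, K θ * F (z + circleMap 0 r θ • v))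
      (∫ θ in (0 : ℝ)..2 * Real.pi, K θ • fderiv ℂ F (z₀ + circleMap 0 r θ • v)) z₀ := by
    refine intervalIntegral.hasFDerivAt_integral_of_dominated_of_fderiv_le
      (F' := fun z θ => K θ • fderiv ℂ F (z + circleMap 0 r θ • v))
      (bound := fun θ => ‖K θ‖ * (2 * M / δ))
      (ball_mem_nhds z₀ hδ) ?_ ?_ ?_ ?_ ?_ ?_
    · filter_upwards [ball_mem_nhds z₀ hδ] with z hz
      exact (hKc.mul (hcontF z hz)).aestronglyMeasurable
    · exact (hKc.mul (hcontF z₀ (mem_ball_self hδ))).intervalIntegrable _ _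
    · refine hKc.aestronglyMeasurable.smul ?_
      have h1 : Measurable fun θ : ℝ => z₀ + circleMap 0 r θ • v :=
        Continuous.measurable (by fun_prop)
      have : SecondCountableTopology ((Fin d → ℂ) →L[ℂ] ℂ) :=
        have : ProperSpace ((Fin d → ℂ) →L[ℂ] ℂ) := FiniteDimensional.proper ℂ _
        inferInstance
      exact ((measurable_fderiv ℂ F).comp h1).aestronglyMeasurable
    · refine Eventually.of_forall fun θ _ z hz => ?_
      rw [norm_smul]
      exact mul_le_mul_of_nonneg_left (hbound _ (hmem z hz _ (hnc θ))) (norm_nonneg _)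
    · exact (hKc.norm.mul continuous_const).intervalIntegrable _ _
    · refine Eventually.of_forall fun θ _ z hz => ?_
      have h1 : HasFDerivAt (fun z => F (z + circleMap 0 r θ • v))
          (fderiv ℂ F (z + circleMap 0 r θ • v)) z := by
        have := (hFd _ (hmem z hz _ (hnc θ))).hasFDerivAt
        exact (hasFDerivAt_comp_add_right _).2 this
      exact h1.const_mul (K θ)
  refine (hD.const_mul (2 * Real.pi * Complex.I)⁻¹).differentiableAt.congr_of_eventuallyEq ?_
  filter_upwards [ball_mem_nhds z₀ hδ] with z hz using hcauchy z hz

/-- The homogeneous components of a holomorphic function on the polydisc are polynomials. -/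
lemma exists_iteratedDeriv_eq_eval {d : ℕ} (j : ℕ) :
    ∀ {F : (Fin d → ℂ) → ℂ}, DifferentiableOn ℂ F (polydisc d) →
      ∃ P : MvPolynomial (Fin d) ℂ, ∀ z,
        iteratedDeriv j (fun t : ℂ => F (t • z)) 0 = eval z P := by
  induction j with
  | zero => exact fun {F} _ => ⟨C (F 0), fun z => by simp⟩
  | succ j ih =>
    intro F hF
    have hpart : ∀ i : Fin d, DifferentiableOn ℂ (fun z => fderiv ℂ F z (Pi.single i 1))
        (polydisc d) := fun i => differentiableOn_fderiv_apply (isOpen_polydisc d) hF _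
    choose P hP using fun i => ih (hpart i)
    refine ⟨∑ i, X i * P i, fun z => ?_⟩
    have hnear : ∀ᶠ t : ℂ in 𝓝 0, t • z ∈ polydisc d := by
      have hc : Continuous fun t : ℂ => t • z := by fun_prop
      exact hc.continuousAt.eventually ((isOpen_polydisc d).mem_nhds
        (by simpa using zero_mem_polydisc d))
    -- One derivative in `t` costs a factor `z i` and replaces `F` by its partial derivatives, to
    -- which the induction hypothesis applies.
    have hderiv : deriv (fun t : ℂ => F (t • z)) =ᶠ[𝓝 0]
        fun t => ∑ i, z i * fderiv ℂ F (t • z) (Pi.single i 1) := by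
      filter_upwards [hnear] with t ht
      have h1 : HasDerivAt (fun s : ℂ => s • z) z t := by
        simpa using (hasDerivAt_id t).smul_const z
      have h2 := ((hF.differentiableAt ((isOpen_polydisc d).mem_nhds ht)).hasFDerivAt.comp_hasDerivAt
        t h1).deriv
      exact h2.trans (map_eq_sum_single (fderiv ℂ F (t • z) : (Fin d → ℂ) →ₗ[ℂ] ℂ) z)
    have hdiff : ∀ i, ContDiffAt ℂ j (fun t : ℂ => fderiv ℂ F (t • z) (Pi.single i 1)) 0 := by
      intro i
      have hU : IsOpen {t : ℂ | t • z ∈ polydisc d} :=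
        (isOpen_polydisc d).preimage (by fun_prop : Continuous fun t : ℂ => t • z)
      have h1 : DifferentiableOn ℂ (fun t : ℂ => fderiv ℂ F (t • z) (Pi.single i 1))
          {t : ℂ | t • z ∈ polydisc d} :=
        (hpart i).comp (by fun_prop : Differentiable ℂ fun t : ℂ => t • z).differentiableOn
          fun t ht => ht
      exact (h1.analyticAt (hU.mem_nhds (by simpa using zero_mem_polydisc d))).contDiffAt
    rw [iteratedDeriv_succ', hderiv.iteratedDeriv_eq j,
      iteratedDeriv_fun_sum fun i _ => contDiffAt_const.mul (hdiff i), map_sum]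
    refine Finset.sum_congr rfl fun i _ => ?_
    rw [iteratedDeriv_const_mul_field, hP i z, map_mul, eval_X]

end PartialDerivatives

/-! ### Linear recurrences, generic specialization and a Baire argument on the torus. -/

/-- A system of rows over a domain `R`: either the rows have a common nonzero annihilator, or they
have none after any generic specialization. -/
lemma exists_annihilator_or_generic {R : Type*} [CommRing R] [IsDomain R] {k : ℕ}
    (v : ℕ → Fin k → R) :
    (∃ q : Fin k → R, q ≠ 0 ∧ ∀ n, ∑ i, q i * v n i = 0) ∨
    ∃ D : R, D ≠ 0 ∧ ∀ (φ : R →+* ℂ) (q : Fin k → ℂ),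
      (∀ n, ∑ i, q i * φ (v n i) = 0) → ∀ i, q i * φ D = 0 := by
  let K := FractionRing R
  have hinj : Function.Injective (algebraMap R K) := IsFractionRing.injective R K
  set W : Submodule K (Fin k → K) :=
    Submodule.span K (Set.range fun n i => algebraMap R K (v n i)) with hW
  by_cases htop : W = ⊤
  · right
    -- Every vector of the span has a nonzero multiple with entries in `R` that is annihilated,
    -- after any specialization, by whatever annihilates the specialized rows. The standard basis
    -- vectors then yield `D`.
    have key : ∀ w ∈ W, ∃ (D : R) (u : Fin k → R), D ≠ 0 ∧
        (∀ i, algebraMap R K (u i) = algebraMap R K D * w i) ∧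
        ∀ (φ : R →+* ℂ) (q : Fin k → ℂ), (∀ n, ∑ i, q i * φ (v n i) = 0) →
          ∑ i, q i * φ (u i) = 0 := by
      intro w hw
      induction hw using Submodule.span_induction with
      | mem w hw =>
        obtain ⟨n, rfl⟩ := hw
        exact ⟨1, v n, one_ne_zero, fun i => by simp, fun φ q h => h n⟩
      | zero => exact ⟨1, 0, one_ne_zero, fun i => by simp, fun φ q h => by simp⟩
      | add x y _ _ hx hy =>
        obtain ⟨D₁, u₁, h₁, e₁, z₁⟩ := hx
        obtain ⟨D₂, u₂, h₂, e₂, z₂⟩ := hy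
        refine ⟨D₁ * D₂, fun i => D₂ * u₁ i + D₁ * u₂ i, mul_ne_zero h₁ h₂, fun i => ?_,
          fun φ q h => ?_⟩
        · simp only [map_add, map_mul, e₁, e₂, Pi.add_apply]; ring
        · have e3 : ∑ i, q i * φ (D₂ * u₁ i + D₁ * u₂ i) =
              φ D₂ * ∑ i, q i * φ (u₁ i) + φ D₁ * ∑ i, q i * φ (u₂ i) := by
            rw [Finset.mul_sum, Finset.mul_sum, ← Finset.sum_add_distrib]
            refine Finset.sum_congr rfl fun i _ => ?_
            rw [map_add, map_mul, map_mul]; ring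
          rw [e3, z₁ φ q h, z₂ φ q h, mul_zero, mul_zero, add_zero]
      | smul a x _ hx =>
        obtain ⟨D, u, h, e, z⟩ := hx
        obtain ⟨α, β, hβ, rfl⟩ := IsFractionRing.div_surjective (A := R) a
        refine ⟨β * D, fun i => α * u i, mul_ne_zero (nonZeroDivisors.ne_zero hβ) h, fun i => ?_,
          fun φ q hq => ?_⟩
        · have hβ' : algebraMap R K β ≠ 0 := by
            rw [Ne, map_eq_zero_iff _ hinj]; exact nonZeroDivisors.ne_zero hβ
          have e4 : algebraMap R K β * (algebraMap R K α / algebraMap R K β) = algebraMap R K α :=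
            mul_div_cancel₀ _ hβ'
          simp only [map_mul, e, Pi.smul_apply, smul_eq_mul]
          linear_combination (-(algebraMap R K D * x i)) * e4
        · have e3 : ∑ i, q i * φ (α * u i) = φ α * ∑ i, q i * φ (u i) := by
            rw [Finset.mul_sum]
            refine Finset.sum_congr rfl fun i _ => ?_
            rw [map_mul]; ring
          rw [e3, z φ q hq, mul_zero]
    choose D u hD e z using fun i : Fin k => key (Pi.single i 1) (htop ▸ Submodule.mem_top)
    refine ⟨∏ i, D i, Finset.prod_ne_zero_iff.2 fun i _ => hD i, fun φ q hq i => ?_⟩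
    have hu : ∀ j, u i j = if j = i then D i else 0 := by
      intro j
      apply hinj
      rw [e i j, Pi.single_apply]
      split_ifs <;> simp
    have h1 := z i φ q hq
    simp only [hu] at h1
    rw [Finset.sum_eq_single i (fun j _ hj => by simp [hj]) (by simp), if_pos rfl] at h1
    rw [map_prod, ← Finset.mul_prod_erase _ _ (Finset.mem_univ i), ← mul_assoc, h1, zero_mul]
  · left
    -- A proper subspace lies in the kernel of a nonzero functional; clearing the denominators of
    -- its coordinates gives the annihilator.
    obtain ⟨f, hf, hle⟩ := W.exists_le_ker_of_lt_top (lt_top_iff_ne_top.2 htop)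
    obtain ⟨b, hb⟩ := IsLocalization.exist_integer_multiples_of_finite (nonZeroDivisors R)
      fun i : Fin k => f (Pi.single i 1)
    choose q hq using hb
    have hb0 : algebraMap R K b ≠ 0 := by
      rw [Ne, map_eq_zero_iff _ hinj]; exact nonZeroDivisors.coe_ne_zero b
    have hfw := map_eq_sum_single f
    have hq' : ∀ i, algebraMap R K (q i) = algebraMap R K b * f (Pi.single i 1) := fun i => by
      rw [hq i, Algebra.smul_def]
    refine ⟨q, fun h0 => hf ?_, fun n => ?_⟩
    · refine LinearMap.ext fun w => ?_
      rw [hfw w, LinearMap.zero_apply]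
      refine Finset.sum_eq_zero fun i _ => ?_
      have := hq' i
      rw [h0, Pi.zero_apply, map_zero, eq_comm, mul_eq_zero] at this
      rw [this.resolve_left hb0, mul_zero]
    · apply hinj
      have h1 : f (fun i => algebraMap R K (v n i)) = 0 := hle (Submodule.subset_span ⟨n, rfl⟩)
      rw [hfw] at h1
      rw [map_sum, map_zero, ← mul_zero (algebraMap R K b), ← h1, Finset.mul_sum]
      refine Finset.sum_congr rfl fun i _ => ?_
      rw [map_mul, hq' i]; ring

/-- Countably many nonzero polynomials have a common nonzero on the torus. -/
lemma exists_torusMap_forall_eval_ne_zero {d : ℕ} (D : ℕ → MvPolynomial (Fin d) ℂ)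
    (hD : ∀ m, D m ≠ 0) : ∃ θ : Fin d → ℝ, ∀ m, eval (torusMap 0 1 θ) (D m) ≠ 0 := by
  by_contra! hno
  -- By Baire, countably many closed zero sets cover the parameter space only if one of them has
  -- interior, which forces its polynomial to vanish.
  obtain ⟨m, θ₀, hθ₀⟩ := nonempty_interior_of_iUnion_of_closed
    (f := fun m => {θ : Fin d → ℝ | eval (torusMap 0 1 θ) (D m) = 0})
    (fun m => isClosed_eq ((differentiable_eval (D m)).continuous.comp (continuous_torusMap d))
      continuous_const)
    (Set.eq_univ_of_forall fun θ => Set.mem_iUnion.2 (hno θ))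
  exact hD m (eq_zero_of_eventually_eval_torusMap_eq_zero (mem_interior_iff_mem_nhds.1 hθ₀))

/-! ### Inner functions in the polydisc algebra are rational. -/

section Rationality

open Metric

lemma smul_mem_polydisc {d : ℕ} {z : Fin d → ℂ} (hz : ∀ i, ‖z i‖ ≤ 1) {t : ℂ} (ht : ‖t‖ < 1) :
    t • z ∈ polydisc d := by
  intro i
  rw [Pi.smul_apply, norm_smul]
  exact (mul_le_of_le_one_right (norm_nonneg t) (hz i)).trans_lt ht

lemma differentiableOn_slice {d : ℕ} {F : (Fin d → ℂ) → ℂ}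
    (hF : DifferentiableOn ℂ F (polydisc d)) {z : Fin d → ℂ} (hz : ∀ i, ‖z i‖ ≤ 1) :
    DifferentiableOn ℂ (fun t : ℂ => F (t • z)) (ball 0 1) :=
  hF.comp (by fun_prop : Differentiable ℂ fun t : ℂ => t • z).differentiableOn fun _ ht =>
    smul_mem_polydisc hz (by simpa using ht)

lemma isDiscInner_slice {d : ℕ} {F : (Fin d → ℂ) → ℂ}
    (hc : ContinuousOn F {z | ∀ i, ‖z i‖ ≤ 1}) (hF : DifferentiableOn ℂ F (polydisc d))
    (hT : ∀ ζ ∈ torus d, ‖F ζ‖ = 1) {ζ : Fin d → ℂ} (hζ : ζ ∈ torus d) :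
    IsDiscInner fun t : ℂ => F (t • ζ) := by
  refine ⟨⟨differentiableOn_slice hF fun i => (hζ i).le, ?_⟩, fun t ht => hT _ fun i => ?_⟩
  · rw [closure_ball _ one_ne_zero]
    refine hc.comp (by fun_prop : Continuous fun t : ℂ => t • ζ).continuousOn fun t ht i => ?_
    rw [Pi.smul_apply, norm_smul, hζ i, mul_one]
    simpa using ht
  · rw [Pi.smul_apply, norm_smul, hζ i, mul_one]
    simpa using ht

lemma exists_taylorCoeff_slice_eq_eval {d : ℕ} {F : (Fin d → ℂ) → ℂ}
    (hF : DifferentiableOn ℂ F (polydisc d)) (j : ℕ) :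
    ∃ P : MvPolynomial (Fin d) ℂ, ∀ z : Fin d → ℂ, (∀ i, ‖z i‖ ≤ 1) →
      taylorCoeff (fun t : ℂ => F (t • z)) j = eval z P := by
  obtain ⟨P, hP⟩ := exists_iteratedDeriv_eq_eval j hF
  refine ⟨C (j.factorial : ℂ)⁻¹ * P, fun z hz => ?_⟩
  rw [taylorCoeff_eq (differentiableOn_slice hF hz), hP, map_mul, eval_C]

/-- If the slices of `F` through the torus are inner, then the homogeneous components of `F` satisfy
a linear recurrence with polynomial coefficients. -/
lemma exists_recurrence {d : ℕ} {F : (Fin d → ℂ) → ℂ}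
    (hF : DifferentiableOn ℂ F (polydisc d))
    (hT : ∀ ζ ∈ torus d, IsDiscInner fun t : ℂ => F (t • ζ))
    {c : ℕ → MvPolynomial (Fin d) ℂ} (hcoef : ∀ (j : ℕ) (z : Fin d → ℂ), (∀ i, ‖z i‖ ≤ 1) →
      taylorCoeff (fun t : ℂ => F (t • z)) j = eval z (c j)) :
    ∃ (m : ℕ) (q : Fin (m + 1) → MvPolynomial (Fin d) ℂ), q ≠ 0 ∧
      ∀ n, ∑ i, q i * c (n + m + 1 - i) = 0 := by
  by_contra! hno
  -- If no recurrence exists, each order `m` has a nonzero polynomial `D m` off whose zeros the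
  -- specialized rows have no annihilator. At a torus point where no `D m` vanishes the slice is
  -- still some `P / Q`, and the coefficients of `Q` annihilate the rows of order `m = max (deg P)
  -- (deg Q)`.
  have hgen := fun m : ℕ => (exists_annihilator_or_generic
    fun n (i : Fin (m + 1)) => c (n + m + 1 - i)).resolve_left (by
      rintro ⟨q, hq, h⟩
      obtain ⟨n, hn⟩ := hno m q hq
      exact hn (h n))
  choose D hD hDq using hgen
  obtain ⟨θ, hθ⟩ := exists_torusMap_forall_eval_ne_zero D hD
  set ζ := torusMap 0 1 θ with hζdef
  have hζ : ζ ∈ torus d := torusMap_mem_torus θ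
  have hζ1 : ∀ i, ‖ζ i‖ ≤ 1 := fun i => (hζ i).le
  obtain ⟨P, Q, hQ, hPQ⟩ := (hT ζ hζ).exists_polynomial
  set m := max P.natDegree Q.natDegree
  have hsum : ∀ n, ∑ i : Fin (m + 1), Q.coeff i * eval ζ (c (n + m + 1 - i)) = 0 := by
    intro n
    have h1 := taylorCoeff_polynomial_mul (differentiableOn_slice hF hζ1)
      (fun i : Fin (m + 1) => Q.coeff i) (n + m + 1)
    have h2 : taylorCoeff (fun z => F (z • ζ) * ∑ i : Fin (m + 1), Q.coeff i * z ^ (i : ℕ))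
        (n + m + 1) = 0 := by
      have hP : P.natDegree < n + m + 1 := by
        have := le_max_left P.natDegree Q.natDegree
        omega
      rw [← taylorCoeff_polynomial hP]
      refine taylorCoeff_congr (fun z hz => ?_) _
      have hQm : Q.natDegree < m + 1 := Nat.lt_succ_of_le (le_max_right _ _)
      rw [← hPQ z hz, Polynomial.eval_eq_sum_range' hQm, Finset.sum_range]
    rw [h2] at h1
    rw [h1]
    refine Finset.sum_congr rfl fun i _ => ?_
    rw [if_pos (by omega), hcoef _ ζ hζ1]
  refine hQ (Polynomial.ext fun i => ?_)
  rw [Polynomial.coeff_zero]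
  by_cases hi : i < m + 1
  · exact (mul_eq_zero.1 (hDq m (eval ζ) (fun i => Q.coeff i) hsum ⟨i, hi⟩)).resolve_right (hθ m)
  · refine Polynomial.coeff_eq_zero_of_natDegree_lt ?_
    have := le_max_right P.natDegree Q.natDegree
    omega

/-- Inner functions in the polydisc algebra are rational. -/
lemma exists_polynomial_mul_eq_of_inner {d : ℕ} {F : (Fin d → ℂ) → ℂ}
    (hc : ContinuousOn F {z | ∀ i, ‖z i‖ ≤ 1}) (hF : DifferentiableOn ℂ F (polydisc d))
    (hT : ∀ ζ ∈ torus d, ‖F ζ‖ = 1) :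
    ∃ A B : MvPolynomial (Fin d) ℂ, B ≠ 0 ∧ ∀ z ∈ polydisc d, F z * eval z B = eval z A := by
  choose c hcoef using exists_taylorCoeff_slice_eq_eval hF
  obtain ⟨m, q, hq, hrec⟩ := exists_recurrence hF (fun ζ hζ => isDiscInner_slice hc hF hT hζ) hcoef
  -- a point where the denominator does not degenerate
  obtain ⟨s, hs1, hs0, hsq⟩ : ∃ s : ℂ, ‖s‖ < 1 ∧ s ≠ 0 ∧ ∑ i, q i * C (s ^ (i : ℕ)) ≠ 0 := by
    by_contra! hall
    set Q : Polynomial (MvPolynomial (Fin d) ℂ) :=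
      ∑ i : Fin (m + 1), Polynomial.C (q i) * Polynomial.X ^ (i : ℕ) with hQ
    have hQ0 : Q = 0 := by
      refine Polynomial.eq_zero_of_infinite_isRoot _ (Set.Infinite.mono (s := C '' (ball 0 1 \ {0}))
        ?_ (Set.Infinite.image (C_injective _ _).injOn ?_))
      · rintro _ ⟨s, ⟨hs, hs0⟩, rfl⟩
        simpa [Polynomial.IsRoot, hQ, Polynomial.eval_finsetSum] using
          hall s (by simpa using hs) hs0
      · exact (infinite_of_mem_nhds (0 : ℂ) (ball_mem_nhds 0 one_pos)).sdiff (Set.finite_singleton 0)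
    refine hq (funext fun i => ?_)
    have h1 := congrArg (fun p => Polynomial.coeff p i) hQ0
    simpa [hQ, Polynomial.finsetSum_coeff, Polynomial.coeff_C_mul, Polynomial.coeff_X_pow,
      Fin.val_inj] using h1
  set B₁ := ∑ i, q i * C (s ^ (i : ℕ)) with hB₁
  set A₁ : MvPolynomial (Fin d) ℂ := ∑ k ∈ Finset.range (m + 1), C (s ^ k) *
    ∑ i : Fin (m + 1), q i * if (i : ℕ) ≤ k then c (k - i) else 0 with hA₁
  -- By the recurrence, `F (t z) ∑ q i (z) t^i` has no Taylor coefficient in `t` beyond degree `m`;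
  -- `A₁` is the sum of the remaining terms at `t = s`.
  have hslice : ∀ z : Fin d → ℂ, (∀ i, ‖z i‖ ≤ 1) → F (s • z) * eval z B₁ = eval z A₁ := by
    intro z hz
    have hd1 := differentiableOn_slice hF hz
    set g : ℂ → ℂ := fun t => F (t • z) * ∑ i : Fin (m + 1), eval z (q i) * t ^ (i : ℕ) with hg
    have hgd : DifferentiableOn ℂ g (ball 0 1) :=
      hd1.fun_mul (by fun_prop : Differentiable ℂ fun t : ℂ =>
        ∑ i : Fin (m + 1), eval z (q i) * t ^ (i : ℕ)).differentiableOn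
    have hco : ∀ k, taylorCoeff g k =
        eval z (∑ i : Fin (m + 1), q i * if (i : ℕ) ≤ k then c (k - i) else 0) := by
      intro k
      rw [hg, taylorCoeff_polynomial_mul hd1, map_sum]
      refine Finset.sum_congr rfl fun i _ => ?_
      rw [map_mul]
      split_ifs
      · rw [hcoef _ z hz]
      · simp
    have hzero : ∀ k ∉ Finset.range (m + 1), taylorCoeff g k * s ^ k = 0 := by
      intro k hk
      rw [Finset.mem_range, not_lt] at hk
      obtain ⟨n, rfl⟩ := Nat.exists_eq_add_of_le' hk
      rw [hco, ← add_assoc]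
      have h1 := hrec n
      have h2 : ∑ i : Fin (m + 1), (q i * if (i : ℕ) ≤ n + m + 1 then c (n + m + 1 - i) else 0) =
          ∑ i, q i * c (n + m + 1 - i) :=
        Finset.sum_congr rfl fun i _ => by rw [if_pos (by omega)]
      rw [h2, h1, map_zero, zero_mul]
    have h1 := (hasSum_taylorCoeff hgd (z := s) (by simpa using hs1)).unique
      (hasSum_sum_of_ne_finset_zero hzero)
    have h2 : eval z B₁ = ∑ i : Fin (m + 1), eval z (q i) * s ^ (i : ℕ) := by
      simp [hB₁, map_sum]
    rw [h2]
    refine h1.trans ?_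
    rw [hA₁, map_sum]
    refine Finset.sum_congr rfl fun k _ => ?_
    rw [hco, map_mul, eval_C, mul_comm]
  -- Replacing `z` by `z / s` turns the identity for `F (s z)` into one for `F z`, so far only for
  -- `z` of modulus at most `|s|` in each coordinate.
  set scale : MvPolynomial (Fin d) ℂ →ₐ[ℂ] MvPolynomial (Fin d) ℂ :=
    aeval fun i => C s⁻¹ * X i with hscale
  have hev : ∀ (p : MvPolynomial (Fin d) ℂ) (z : Fin d → ℂ),
      eval z (scale p) = eval (s⁻¹ • z) p := by
    intro p z
    induction p using MvPolynomial.induction_on with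
    | C a => simp [hscale]
    | add p q hp hq => simp only [map_add, hp, hq]
    | mul_X p i hp => rw [map_mul, map_mul, map_mul, hp]; simp [hscale]
  refine ⟨scale A₁, scale B₁, fun h0 => hsq ?_, fun z hz => ?_⟩
  · refine MvPolynomial.funext fun w => ?_
    have := hev B₁ (s • w)
    rw [h0, inv_smul_smul₀ hs0] at this
    simpa using this.symm
  -- The identity theorem on the line through `z` carries the identity from small `t` to `t = 1`;
  -- `U` is connected because it is convex.
  · set U : Set ℂ := {t | t • z ∈ polydisc d}
    have hUo : IsOpen U := (isOpen_polydisc d).preimage (by fun_prop : Continuous fun t : ℂ => t • z)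
    have hUc : IsPreconnected U := by
      refine Convex.isPreconnected ?_
      have h1 : polydisc d = ball 0 1 := by
        ext w
        rw [mem_ball_zero_iff, pi_norm_lt_iff one_pos]
        rfl
      have h2 := (convex_ball (0 : Fin d → ℂ) 1).linear_preimage
        ((LinearMap.toSpanSingleton ℂ (Fin d → ℂ) z).restrictScalars ℝ)
      rw [← h1] at h2
      exact h2
    have h0U : (0 : ℂ) ∈ U := by simpa [U] using zero_mem_polydisc d
    have h1U : (1 : ℂ) ∈ U := by simpa [U] using hz
    have hφ : DifferentiableOn ℂ
        (fun t : ℂ => F (t • z) * eval (t • z) (scale B₁) - eval (t • z) (scale A₁)) U := by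
      have hl : Differentiable ℂ fun t : ℂ => t • z := by fun_prop
      refine ((hF.comp hl.differentiableOn fun t ht => ht).fun_mul
        ((differentiable_eval (scale B₁)).comp hl).differentiableOn).fun_sub
        ((differentiable_eval (scale A₁)).comp hl).differentiableOn
    have hnear : (fun t : ℂ => F (t • z) * eval (t • z) (scale B₁) - eval (t • z) (scale A₁))
        =ᶠ[𝓝 0] fun _ => 0 := by
      filter_upwards [ball_mem_nhds (0 : ℂ) (norm_pos_iff.2 hs0)] with t ht
      rw [hev, hev, sub_eq_zero]
      have h2 := hslice (s⁻¹ • t • z) fun i => by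
        rw [smul_smul, Pi.smul_apply, norm_smul, norm_mul, norm_inv]
        have h3 : ‖t‖ < ‖s‖ := by simpa using ht
        refine mul_le_one₀ ?_ (norm_nonneg _) (hz i).le
        rw [inv_mul_le_one₀ (norm_pos_iff.2 hs0)]
        exact h3.le
      rwa [smul_inv_smul₀ hs0] at h2
    have := (hφ.analyticOnNhd hUo).eqOn_of_preconnected_of_eventuallyEq
      (fun _ _ => analyticAt_const) hUc h0U hnear h1U
    simpa [sub_eq_zero] using this

end Rationality

/-! ### Absence of zeros of the denominator on the boundary. -/

/-- A rational inner function that is continuous on the closed polydisc has no singularities on the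
torus. -/
lemma eval_ne_zero_on_torus {d : ℕ} {F : (Fin d → ℂ) → ℂ} {A B : MvPolynomial (Fin d) ℂ}
    (hAB : IsRelPrime A B) (hB : ∀ z ∈ polydisc d, eval z B ≠ 0)
    (hc : ContinuousOn F {z | ∀ i, ‖z i‖ ≤ 1}) (hT : ∀ ζ ∈ torus d, ‖F ζ‖ = 1)
    (hFB : ∀ z : Fin d → ℂ, (∀ i, ‖z i‖ ≤ 1) → F z * eval z B = eval z A)
    (hrefl : ∀ z : Fin d → ℂ, (∀ i, z i ≠ 0) → eval (fun i => 1 / conj (z i)) B = 0 →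
      eval z A = 0) : ∀ ζ ∈ torus d, eval ζ B ≠ 0 := by
  intro ζ₀ hζ₀ hz
  have hB0 := hB 0 (zero_mem_polydisc d)
  have hBne : B ≠ 0 := by rintro rfl; simp at hB0
  obtain ⟨q, hq, ⟨k, rfl⟩, hqz⟩ := exists_irreducible_factor_eval_eq_zero hBne hz
  have hq0 : eval 0 q ≠ 0 := by rw [map_mul] at hB0; exact left_ne_zero_of_mul hB0
  have hqA : ¬ q ∣ A := fun hdvd => hq.not_isUnit (hAB hdvd (dvd_mul_right _ _))
  obtain ⟨R, hR, hel⟩ := exists_elimination hq hq0 hqA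
  obtain ⟨θ₀, rfl⟩ := exists_torusMap_eq hζ₀
  refine hR (eq_zero_of_eventually_eval_torusMap_eq_zero (θ₀ := θ₀) ?_)
  -- `F` is unimodular at the torus point, hence nonzero nearby in the closed polydisc; this is
  -- needed at the reflection of `t • ζ`, where `ζ` is on the torus, when that reflection lies
  -- inside.
  have hFne : ∀ᶠ p : (Fin d → ℂ) × ℂ in 𝓝 (torusMap 0 1 θ₀, 1),
      (∀ i, ‖((1 / conj p.2) • p.1) i‖ ≤ 1) → F ((1 / conj p.2) • p.1) ≠ 0 := by
    have h1 : ∀ᶠ w in 𝓝 (torusMap 0 1 θ₀), (∀ i, ‖w i‖ ≤ 1) → F w ≠ 0 := by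
      have hne : F (torusMap 0 1 θ₀) ≠ 0 := by
        rw [← norm_ne_zero_iff, hT _ hζ₀]; exact one_ne_zero
      have h2 := (hc (torusMap 0 1 θ₀) fun i => (hζ₀ i).le).eventually (isOpen_ne.mem_nhds hne)
      exact eventually_nhdsWithin_iff.1 h2
    have h3 : ContinuousAt (fun p : (Fin d → ℂ) × ℂ => (1 / conj p.2) • p.1)
        (torusMap 0 1 θ₀, 1) := by
      refine ContinuousAt.smul (ContinuousAt.div continuousAt_const
        (Complex.continuous_conj.comp continuous_snd).continuousAt (by simp)) continuousAt_fst
    have h4 := h3.tendsto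
    simp only [map_one, div_one, one_smul] at h4
    exact h4.eventually h1
  rw [nhds_prod_eq, eventually_prod_iff] at hFne
  obtain ⟨pa, hpa, pb, hpb, hpab⟩ := hFne
  obtain ⟨ε, hε, hball⟩ := Metric.eventually_nhds_iff_ball.1 hpb
  have hroot := eventually_exists_zero_near (φ := fun z t => eval (0 + t • z) q)
    (continuous_eval_add_smul 0 q) (fun z => differentiable_eval_add_smul 0 z q)
    (x₀ := torusMap 0 1 θ₀) (t₀ := 1) (t₁ := 0) (by simpa using hqz) (by simpa using hq0) hε
  have hcont := (continuous_torusMap d).tendsto θ₀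
  filter_upwards [hcont.eventually hpa, hcont.eventually hroot] with θ hθ ⟨t, ht, hqt⟩
  refine hel _ t hqt ?_
  rw [zero_add] at hqt ⊢
  set ζ := torusMap 0 1 θ
  have hζ : ζ ∈ torus d := torusMap_mem_torus θ
  have hBt : eval (t • ζ) (q * k) = 0 := by rw [map_mul, hqt, zero_mul]
  rcases le_or_gt ‖t‖ 1 with ht1 | ht1
  · rw [← hFB (t • ζ) fun i => by rw [Pi.smul_apply, norm_smul, hζ i, mul_one]; exact ht1, hBt,
      mul_zero]
  -- A zero `t • ζ` of `B` outside the polydisc reflects to a zero of `A` inside it, where `F B = A`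
  -- with neither `F` nor `B` vanishing.
  · exfalso
    have ht0 : t ≠ 0 := by rintro rfl; simp at ht1; linarith
    have hs : ‖1 / conj t‖ < 1 := by
      rw [norm_div, norm_one, RCLike.norm_conj, div_lt_one (by linarith)]
      exact ht1
    have hmem : (1 / conj t) • ζ ∈ polydisc d := smul_mem_polydisc (fun i => (hζ i).le) hs
    have hle : ∀ i, ‖((1 / conj t) • ζ) i‖ ≤ 1 := fun i => (hmem i).le
    have h1 := hFB _ hle
    rw [hrefl] at h1
    · exact mul_ne_zero (hpab hθ (hball t ht) hle) (hB _ hmem) h1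
    · intro i
      have : ζ i ≠ 0 := by rw [← norm_ne_zero_iff, hζ i]; exact one_ne_zero
      simp [ht0, this]
    · rw [← hBt]
      congr 2
      ext i
      have := one_div_conj_of_norm_eq_one (hζ i)
      rw [Pi.smul_apply, Pi.smul_apply, smul_eq_mul, smul_eq_mul, map_mul, map_div₀, map_one,
        Complex.conj_conj, one_div_mul_eq_div, one_div_div]
      rw [div_eq_mul_one_div, this]

lemma tendsto_dilation {d : ℕ} (x : Fin d → ℂ) :
    Tendsto (fun r : ℝ => dilation r x) (𝓝[<] 1) (𝓝 x) := by
  have hc : Continuous fun r : ℝ => dilation r x :=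
    continuous_dilation.comp (by fun_prop : Continuous fun r : ℝ => (r, x))
  simpa [dilation_one] using (hc.tendsto 1).mono_left (nhdsWithin_le_nhds (s := Set.Iio (1 : ℝ)))

/-- On the compact set of tori of radius between `1 / 2` and `1`, `|b|` has a positive minimum. The
maximum principle for the reciprocal of the dilated `b` makes this minimum a lower bound at
`dilation r x`, uniformly as `r → 1`. -/
lemma eval_ne_zero_on_closure {d : ℕ} {b : MvPolynomial (Fin d) ℂ}
    (hG : ∀ x ∈ symPolydisc d, eval x b ≠ 0)
    (hT : ∀ ζ ∈ torus d, eval (symmetrization d ζ) b ≠ 0) :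
    ∀ x ∈ closure (symPolydisc d), eval x b ≠ 0 := by
  intro x hx
  have hcont : Continuous fun p : ℝ × (Fin d → ℂ) => ‖eval (dilation p.1 p.2) b‖ :=
    ((differentiable_eval b).continuous.comp continuous_dilation).norm
  have hmin : ∃ r₀ ∈ Set.Icc (1 / 2 : ℝ) 1, ∃ ζ₀ ∈ torus d, ∀ r ∈ Set.Icc (1 / 2 : ℝ) 1,
      ∀ ζ ∈ torus d, ‖eval (dilation r₀ (symmetrization d ζ₀)) b‖ ≤
        ‖eval (dilation r (symmetrization d ζ)) b‖ := by
    obtain ⟨p, hp, hmin⟩ := (isCompact_Icc.prod (isCompact_torus d)).exists_isMinOn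
      (⟨(1, fun _ => 1), ⟨by norm_num, le_rfl⟩, fun i => by simp⟩ :
        (Set.Icc (1 / 2 : ℝ) 1 ×ˢ torus d).Nonempty)
      (hcont.comp (continuous_fst.prodMk
        ((continuous_symmetrization d).comp continuous_snd))).continuousOn
    exact ⟨p.1, hp.1, p.2, hp.2, fun r hr ζ hζ => isMinOn_iff.1 hmin (r, ζ) ⟨hr, hζ⟩⟩
  obtain ⟨r₀, hr₀, ζ₀, hζ₀, hmin⟩ := hmin
  generalize hm : ‖eval (dilation r₀ (symmetrization d ζ₀)) b‖ = m at hmin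
  have hcl : ∀ {ζ}, ζ ∈ torus d → symmetrization d ζ ∈ closure (symPolydisc d) := fun hζ =>
    closedPolydisc_mapsTo d fun i => (hζ i).le
  have hm0 : 0 < m := by
    rw [← hm, norm_pos_iff]
    rcases hr₀.2.lt_or_eq with h | h
    · exact hG _ (dilation_mem_symPolydisc (by linarith [hr₀.1]) h (hcl hζ₀))
    · rw [h, dilation_one]
      exact hT ζ₀ hζ₀
  have key : ∀ r : ℝ, 1 / 2 ≤ r → r < 1 → m ≤ ‖eval (dilation r x) b‖ := by
    intro r hr hr1
    have hne : ∀ y ∈ closure (symPolydisc d), eval (dilation r y) b ≠ 0 := fun y hy =>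
      hG _ (dilation_mem_symPolydisc (by linarith) hr1 hy)
    have hd : Differentiable ℂ fun y : Fin d → ℂ => eval (dilation r y) b :=
      (differentiable_eval b).comp (differentiable_dilation r)
    have hA : MemUniformAlgebra (symPolydisc d) fun y => (eval (dilation r y) b)⁻¹ :=
      ⟨hd.continuous.continuousOn.inv₀ hne,
        hd.differentiableOn.fun_inv fun y hy => hne y (subset_closure hy)⟩
    obtain ⟨y, ⟨ζ, hζ, hy⟩, hle⟩ := (isClosedBoundary_torus d).2.2 _ hA x hx
    have hyc : y ∈ closure (symPolydisc d) := hy ▸ hcl hζ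
    have h1 : ‖eval (dilation r y) b‖ ≤ ‖eval (dilation r x) b‖ := by
      simp only [norm_inv] at hle
      exact (inv_le_inv₀ (norm_pos_iff.2 (hne x hx)) (norm_pos_iff.2 (hne y hyc))).1 hle
    have h2 : m ≤ ‖eval (dilation r y) b‖ := hy ▸ hmin r ⟨hr, hr1.le⟩ ζ hζ
    exact h2.trans h1
  have hlim : Tendsto (fun r : ℝ => ‖eval (dilation r x) b‖) (𝓝[<] 1) (𝓝 ‖eval x b‖) :=
    (((differentiable_eval b).continuous.tendsto x).comp (tendsto_dilation x)).norm
  refine norm_pos_iff.1 (hm0.trans_le (ge_of_tendsto hlim ?_))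
  filter_upwards [Ico_mem_nhdsLT (show (1 / 2 : ℝ) < 1 by norm_num)] with r hr
  exact key r hr.1 hr.2

/-! ### From almost everywhere to everywhere on the torus, and the three statements. -/

/-- The parameter box lies in the closure of its interior, so almost everywhere equality of
continuous functions is equality on the whole box, which covers the torus. -/
lemma eqOn_torus_of_ae_eq {d : ℕ} {φ ψ : (Fin d → ℂ) → ℝ} (hφ : ContinuousOn φ (torus d))
    (hψ : ContinuousOn ψ (torus d))
    (h : ∀ᵐ θ ∂(volume.restrict (Set.Icc (0 : Fin d → ℝ) fun _ => 2 * Real.pi)),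
      φ (torusMap 0 1 θ) = ψ (torusMap 0 1 θ)) : Set.EqOn φ ψ (torus d) := by
  have hcomp : ∀ {χ : (Fin d → ℂ) → ℝ}, ContinuousOn χ (torus d) →
      Continuous fun θ : Fin d → ℝ => χ (torusMap 0 1 θ) := fun hχ =>
    hχ.comp_continuous (continuous_torusMap d) torusMap_mem_torus
  have hIcc : Set.Icc (0 : Fin d → ℝ) (fun _ => 2 * Real.pi) ⊆
      closure (interior (Set.Icc (0 : Fin d → ℝ) fun _ => 2 * Real.pi)) := by
    rw [← Set.pi_univ_Icc, interior_pi_set Set.finite_univ, closure_pi_set]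
    refine Set.pi_mono fun i _ => ?_
    rw [interior_Icc, closure_Ioo]
    simp [Real.pi_pos.ne']
  have heq := Measure.eqOn_of_ae_eq h (hcomp hφ).continuousOn (hcomp hψ).continuousOn hIcc
  intro ζ hζ
  obtain ⟨θ, hθ, rfl⟩ : ∃ θ ∈ Set.Icc (0 : Fin d → ℝ) fun _ => 2 * Real.pi, torusMap 0 1 θ = ζ := by
    refine ⟨fun i => if (ζ i).arg < 0 then (ζ i).arg + 2 * Real.pi else (ζ i).arg,
      ⟨fun i => ?_, fun i => ?_⟩, ?_⟩
    · simp only [Pi.zero_apply]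
      split_ifs with h0
      · linarith [Complex.neg_pi_lt_arg (ζ i), Real.pi_pos]
      · linarith
    · simp only
      split_ifs with h0
      · linarith
      · linarith [Complex.arg_le_pi (ζ i), Real.pi_pos]
    · ext i
      have h1 := Complex.norm_mul_exp_arg_mul_I (ζ i)
      rw [hζ i, Complex.ofReal_one, one_mul] at h1
      simp only [torusMap, Pi.zero_apply, Pi.one_apply, Complex.ofReal_one, one_mul, zero_add]
      split_ifs
      · rw [Complex.ofReal_add, add_mul, Complex.exp_add, h1]
        push_cast
        rw [Complex.exp_two_pi_mul_I, mul_one]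
      · exact h1
  exact heq hθ

/-- Almost every point of the torus lies over a boundary point where the radial limit of an inner
function exists and is unimodular. -/
lemma IsInner.ae_torusMap {d : ℕ} {f : (Fin d → ℂ) → ℂ} (hf : IsInner f) :
    ∀ᵐ θ ∂(volume.restrict (Set.Icc (0 : Fin d → ℝ) fun _ => 2 * Real.pi)), ∃ w : ℂ, ‖w‖ = 1 ∧
      Tendsto (fun r : ℝ => f (dilation r (symmetrization d (torusMap 0 1 θ)))) (𝓝[<] 1) (𝓝 w) := by
  have hm : Continuous fun θ : Fin d → ℝ => symmetrization d (torusMap 0 1 θ) :=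
    (continuous_symmetrization d).comp (continuous_torusMap d)
  filter_upwards [ae_of_ae_map hm.measurable.aemeasurable hf.2.2] with θ hθ
  refine hθ ?_
  rw [distinguishedBoundary_symPolydisc]
  exact Set.mem_image_of_mem _ (torusMap_mem_torus θ)

lemma eventually_dilation_mem_symPolydisc {d : ℕ} {x : Fin d → ℂ}
    (hx : x ∈ closure (symPolydisc d)) : ∀ᶠ r : ℝ in 𝓝[<] 1, dilation r x ∈ symPolydisc d := by
  filter_upwards [Ico_mem_nhdsLT (zero_lt_one (α := ℝ))] with r hr
  exact dilation_mem_symPolydisc hr.1 hr.2 hx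

/-- If a quotient of polynomials is inner, then numerator and denominator have the same modulus on
the distinguished boundary. -/
lemma IsInner.norm_eval_eq {d : ℕ} {f : (Fin d → ℂ) → ℂ} (hf : IsInner f)
    {a b : MvPolynomial (Fin d) ℂ} (hab : ∀ x ∈ symPolydisc d, f x * eval x b = eval x a) :
    ∀ ζ ∈ torus d, ‖eval (symmetrization d ζ) a‖ = ‖eval (symmetrization d ζ) b‖ := by
  have hc : ∀ q : MvPolynomial (Fin d) ℂ, Continuous fun z => ‖eval (symmetrization d z) q‖ :=
    fun q => ((differentiable_eval q).continuous.comp (continuous_symmetrization d)).norm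
  refine eqOn_torus_of_ae_eq (hc a).continuousOn (hc b).continuousOn ?_
  filter_upwards [hf.ae_torusMap] with θ ⟨w, hw, hlim⟩
  set x := symmetrization d (torusMap 0 1 θ)
  have hx : x ∈ closure (symPolydisc d) :=
    closedPolydisc_mapsTo d fun i => (torusMap_mem_torus θ i).le
  have hq : ∀ q : MvPolynomial (Fin d) ℂ,
      Tendsto (fun r : ℝ => eval (dilation r x) q) (𝓝[<] 1) (𝓝 (eval x q)) := fun q =>
    ((differentiable_eval q).continuous.tendsto x).comp (tendsto_dilation x)
  have h := tendsto_nhds_unique ((hlim.mul (hq b)).congr' <| by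
    filter_upwards [eventually_dilation_mem_symPolydisc hx] with r hr using hab _ hr) (hq a)
  rw [← h, norm_mul, hw, one_mul]

/-- `IsRational` is silent at the zeros of the denominator; the complement of these is dense in the
polydisc, so continuity fills the gap after cross-multiplication. -/
lemma IsRational.exists_polynomial_mul_eq {d : ℕ} {f : (Fin d → ℂ) → ℂ}
    (hf : ContinuousOn f (symPolydisc d)) (h : IsRational f) :
    ∃ A B : MvPolynomial (Fin d) ℂ, B ≠ 0 ∧
      ∀ z ∈ polydisc d, f (symmetrization d z) * eval z B = eval z A := by
  obtain ⟨a, b, hb, hab⟩ := h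
  refine ⟨pullback d a, pullback d b, fun h0 => hb (pullback_injective d (by simpa using h0)), ?_⟩
  intro z hz
  by_contra hne
  have hc : ContinuousOn (fun z => f (symmetrization d z)) (polydisc d) :=
    hf.comp (continuous_symmetrization d).continuousOn fun z hz => ⟨z, hz, rfl⟩
  have hev := ((hc.continuousAt ((isOpen_polydisc d).mem_nhds hz)).mul
    (differentiable_eval (pullback d b)).continuous.continuousAt).sub
    (differentiable_eval (pullback d a)).continuous.continuousAt |>.eventually_ne
      (sub_ne_zero.2 hne)
  have h0 : pullback d b = 0 := by
    refine eq_zero_of_eventually_eval_eq_zero (z₀ := z) ?_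
    filter_upwards [hev, (isOpen_polydisc d).mem_nhds hz] with w hw hwd
    by_contra hbw
    rw [eval_pullback] at hbw
    refine hw ?_
    simp only [Pi.sub_apply, Pi.mul_apply, eval_pullback]
    rw [hab _ ⟨w, hwd, rfl⟩ hbw, div_mul_cancel₀ _ hbw, sub_self]
  exact hb (pullback_injective d (by simpa using h0))

/-- Rational inner functions are of the form `τ p^k conj (ξ (reflection)) / ξ`. -/
theorem IsRationalInner.exists_hasInnerForm {f : (Fin (n + 1) → ℂ) → ℂ} (hf : IsRationalInner f) :
    ∃ (k : ℕ) (τ : ℂ) (ξ : MvPolynomial (Fin (n + 1)) ℂ), ‖τ‖ = 1 ∧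
      (∀ x ∈ symPolydisc (n + 1), eval x ξ ≠ 0) ∧
      HasInnerForm (symPolydisc (n + 1)) f τ k ξ := by
  have hfc : ContinuousOn f (symPolydisc (n + 1)) := hf.2.1.continuousOn
  obtain ⟨A, B, hB, hAB⟩ := hf.1.exists_polynomial_mul_eq hfc
  obtain ⟨a, b, -, hrel, hb, hab⟩ := exists_isRelPrime_mul_eq hfc hB hAB
  obtain ⟨k, τ, hτ, h⟩ := exists_eval_eq_reflection hrel (hb 0 (zero_mem_symPolydisc _))
    (hf.2.norm_eval_eq hab)
  refine ⟨k, τ, b, hτ, hb, fun x hx hx0 => ?_⟩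
  rw [eq_div_iff (hb x hx), hab x hx, h x hx0]

/-- Inner functions in the uniform algebra are of the form `τ p^k conj (ξ (reflection)) / ξ` with `ξ`
free of zeros in the closure of the domain. -/
theorem IsInner.exists_hasInnerForm_closure {f : (Fin (n + 1) → ℂ) → ℂ}
    (hA : MemUniformAlgebra (symPolydisc (n + 1)) f) (hf : IsInner f) :
    ∃ (k : ℕ) (τ : ℂ) (ξ : MvPolynomial (Fin (n + 1)) ℂ), ‖τ‖ = 1 ∧
      (∀ x ∈ closure (symPolydisc (n + 1)), eval x ξ ≠ 0) ∧ IsRational f ∧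
      HasInnerForm (closure (symPolydisc (n + 1))) f τ k ξ := by
  have hFc : ContinuousOn (fun z => f (symmetrization (n + 1) z)) {z | ∀ i, ‖z i‖ ≤ 1} :=
    hA.1.comp (continuous_symmetrization _).continuousOn fun z hz => closedPolydisc_mapsTo _ hz
  have hFd : DifferentiableOn ℂ (fun z => f (symmetrization (n + 1) z)) (polydisc (n + 1)) :=
    hA.2.comp (differentiable_symmetrization _).differentiableOn fun z hz => ⟨z, hz, rfl⟩
  -- Here `f` is continuous up to the boundary, so the radial limits are its boundary values, and
  -- unimodularity almost everywhere becomes unimodularity everywhere.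
  have hFT : ∀ ζ ∈ torus (n + 1), ‖f (symmetrization (n + 1) ζ)‖ = 1 := by
    refine eqOn_torus_of_ae_eq (hFc.mono fun z hz i => (hz i).le).norm continuousOn_const ?_
    filter_upwards [hf.ae_torusMap] with θ ⟨w, hw, hlim⟩
    have hx : symmetrization (n + 1) (torusMap 0 1 θ) ∈ closure (symPolydisc (n + 1)) :=
      closedPolydisc_mapsTo _ fun i => (torusMap_mem_torus θ i).le
    have h := tendsto_nhds_unique hlim ((hA.1 _ hx).tendsto.comp <| tendsto_nhdsWithin_iff.2
      ⟨tendsto_dilation _, (eventually_dilation_mem_symPolydisc hx).mono fun _ h => subset_closure h⟩)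
    rw [← h, hw]
  obtain ⟨A, B, hB, hAB⟩ := exists_polynomial_mul_eq_of_inner hFc hFd hFT
  obtain ⟨a, b, hrel', hrel, hb, hab⟩ := exists_isRelPrime_mul_eq hA.2.continuousOn hB hAB
  have hab' : ∀ x ∈ closure (symPolydisc (n + 1)), f x * eval x b = eval x a :=
    Set.EqOn.of_subset_closure (s := symPolydisc (n + 1)) (fun x hx => hab x hx)
      (hA.1.mul (differentiable_eval b).continuous.continuousOn)
      (differentiable_eval a).continuous.continuousOn subset_closure subset_rfl
  obtain ⟨k, τ, hτ, h⟩ := exists_eval_eq_reflection hrel (hb 0 (zero_mem_symPolydisc _))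
    (hf.norm_eval_eq hab)
  have hbT : ∀ ζ ∈ torus (n + 1), eval (symmetrization (n + 1) ζ) b ≠ 0 := by
    intro ζ hζ
    rw [← eval_pullback]
    refine eval_ne_zero_on_torus hrel' (fun z hz => ?_) hFc hFT (fun z hz => ?_) (fun z hz h0 => ?_)
      ζ hζ
    · rw [eval_pullback]
      exact hb _ ⟨z, hz, rfl⟩
    · rw [eval_pullback, eval_pullback]
      exact hab' _ (closedPolydisc_mapsTo _ hz)
    · rw [eval_pullback, ← reflection_symmetrization hz] at h0
      rw [eval_pullback, h, h0, map_zero, mul_zero]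
      rw [symmetrization_last]
      exact Finset.prod_ne_zero_iff.2 fun i _ => hz i
  have hbc := eval_ne_zero_on_closure hb hbT
  refine ⟨k, τ, b, hτ, hbc, ⟨a, b, fun h0 => ?_, fun x hx hx0 => ?_⟩, fun x hx hx0 => ?_⟩
  · exact hb 0 (zero_mem_symPolydisc _) (by simp [h0])
  · rw [eq_div_iff hx0, hab x hx]
  · rw [eq_div_iff (hbc x hx), hab' x hx, h x hx0]

end SymmetrizedPolydisc

theorem theoremA (n : ℕ) :
    -- every rational inner function has the form
    (∀ f : (Fin (n + 1) → ℂ) → ℂ, SymmetrizedPolydisc.IsRationalInner f →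
      ∃ (k : ℕ) (τ : ℂ) (ξ : MvPolynomial (Fin (n + 1)) ℂ), ‖τ‖ = 1 ∧
        (∀ x ∈ SymmetrizedPolydisc.symPolydisc (n + 1), MvPolynomial.eval x ξ ≠ 0) ∧
        SymmetrizedPolydisc.HasInnerForm (SymmetrizedPolydisc.symPolydisc (n + 1)) f τ k ξ) ∧
    -- every function on the domain of that form is rational inner
    (∀ (k : ℕ) (τ : ℂ) (ξ : MvPolynomial (Fin (n + 1)) ℂ), ‖τ‖ = 1 →
      (∀ x ∈ SymmetrizedPolydisc.symPolydisc (n + 1), MvPolynomial.eval x ξ ≠ 0) →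
      ∀ f : (Fin (n + 1) → ℂ) → ℂ,
        DifferentiableOn ℂ f (SymmetrizedPolydisc.symPolydisc (n + 1)) →
        SymmetrizedPolydisc.HasInnerForm (SymmetrizedPolydisc.symPolydisc (n + 1)) f τ k ξ →
        SymmetrizedPolydisc.IsRationalInner f) ∧
    -- inner functions in the uniform algebra
    (∀ f : (Fin (n + 1) → ℂ) → ℂ,
      SymmetrizedPolydisc.MemUniformAlgebra (SymmetrizedPolydisc.symPolydisc (n + 1)) f →
      SymmetrizedPolydisc.IsInner f →
      ∃ (k : ℕ) (τ : ℂ) (ξ : MvPolynomial (Fin (n + 1)) ℂ), ‖τ‖ = 1 ∧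
        (∀ x ∈ closure (SymmetrizedPolydisc.symPolydisc (n + 1)), MvPolynomial.eval x ξ ≠ 0) ∧
        SymmetrizedPolydisc.IsRational f ∧
        SymmetrizedPolydisc.HasInnerForm (closure (SymmetrizedPolydisc.symPolydisc (n + 1)))
          f τ k ξ) := by
  exact ⟨fun _ hf => hf.exists_hasInnerForm,
    fun _ _ _ hτ hξ _ hf h => SymmetrizedPolydisc.isRationalInner_of_hasInnerForm hτ hξ hf h,
    fun _ hA hf => hf.exists_hasInnerForm_closure hA⟩
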